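/- Let $V=\mathbb{C}^m$ ($m\ge 0$), let $L$ be the free (complex) Lie algebra on $V$, and let $\mathfrak{g}=L^{\oplus n}$ ($n\ge 0$) with componentwise bracket. The symmetric group $S_n$ acts on $\mathfrak g$ by Lie algebra automorphisms permuting the $n$ summands, and $GL(V)$ acts on $\mathfrak g$ by Lie algebra automorphisms through its natural action on each summand $L$. Let $H^i(\mathfrak g,\mathbb C)=\operatorname{Ext}^i_{U(\mathfrak g)}(\mathbb C,\mathbb C)$ be the Lie algebra cohomology with trivial coefficients, where $U(\mathfrak g)$ is the universal enveloping algebra. It carries the commuting actions of $S_n$ and $GL(V)$ induced by functoriality (a group element $a$ acts by the map on cohomology induced by the automorphism $a^{-1}$ of $\mathfrak g$). For every $0\le i\le n$ there is an isomorphism of complex representations of $S_n$ $$H^i(\mathfrak g,\mathbb C)\;\cong\;\operatorname{Ind}_{S_i\times S_{n-i}}^{S_n}\bigl(\bigl((V^*)^{\otimes i}\otimes\varepsilon_i\bigr)\boxtimes \mathbb C\bigr),$$ where $S_i$ permutes the tensor factors of $(V^*)^{\otimes i}$, $\varepsilon_i$ is the sign representation of $S_i$, and $\mathbb C$ is the trivial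 representation of $S_{n-i}$; the isomorphism can be chosen to be also $GL(V)$-equivariant, where $GL(V)$ acts on the right-hand side through the contragredient representation $V^*$. Moreover $H^i(\mathfrak g,\mathbb C)=0$ for all $i>n$. -/

import Mathlib

noncomputable section

open CategoryTheory Limits Abelian

universe w u v u' v' u'' v''

namespace FreeLieCoh

section ExtMap

variable {C : Type u} [Category.{v} C] [Abelian C] [HasExt.{w} C]
  {D : Type u'} [Category.{v'} D] [Abelian D] [HasExt.{w} D]
  {E : Type u''} [Category.{v''} E] [Abelian E] [HasExt.{w} E]

theorem exists_extClass_comp [EnoughProjectives C] {X Y : C} {n : ℕ} (e : Ext X Y (n + 1)) :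
    ∃ (S : ShortComplex C) (hS : S.ShortExact) (h : S.X₃ = X) (e' : Ext S.X₁ Y n),
      e = h ▸ hS.extClass.comp e' (add_comm 1 n) := by
  let S := ShortComplex.mk _ _ (kernel.condition (Projective.π X))
  have hS : S.ShortExact :=
    { exact := ShortComplex.exact_of_f_is_kernel _ (kernelIsKernel S.g) }
  obtain ⟨e', he'⟩ := Ext.contravariant_sequence_exact₃ hS Y e
    (@Ext.eq_zero_of_projective _ _ _ _ (Projective.over X) _ _ _ _) (add_comm 1 n)
  exact ⟨S, hS, rfl, e', he'.symm⟩

theorem mapExactFunctor_natTrans [EnoughProjectives C] {F G : C ⥤ D}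
    [F.Additive] [PreservesFiniteLimits F] [PreservesFiniteColimits F]
    [G.Additive] [PreservesFiniteLimits G] [PreservesFiniteColimits G]
    (τ : F ⟶ G) {X Y : C} {n : ℕ} (e : Ext X Y n) :
    (e.mapExactFunctor F).comp (Ext.mk₀ (τ.app Y)) (add_zero n) =
      (Ext.mk₀ (τ.app X)).comp (e.mapExactFunctor G) (zero_add n) := by
  induction n generalizing X with
  | zero =>
    obtain ⟨f, rfl⟩ := (Ext.mk₀_bijective X Y).2 e
    simp [Ext.mapExactFunctor_mk₀]
  | succ n ih =>
    obtain ⟨S, hS, rfl, e', rfl⟩ := exists_extClass_comp e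
    have key : (hS.extClass.mapExactFunctor F).comp (Ext.mk₀ (τ.app S.X₁)) (add_zero 1) =
        (Ext.mk₀ (τ.app S.X₃)).comp (hS.extClass.mapExactFunctor G) (zero_add 1) := by
      rw [Ext.mapExactFunctor_extClass, Ext.mapExactFunctor_extClass]
      exact ShortComplex.ShortExact.extClass_naturality (hS.map_of_exact F)
        (hS.map_of_exact G) (S.mapNatTrans τ)
    dsimp
    rw [Ext.mapExactFunctor_comp, Ext.mapExactFunctor_comp, Ext.comp_assoc_of_third_deg_zero, ih,
      ← Ext.comp_assoc_of_second_deg_zero, key,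
      Ext.comp_assoc (a₁₂ := 1) (a₂₃ := n + 1) _ _ _ (by lia) (by lia) (by lia)]

theorem mapExactFunctor_id [EnoughProjectives C] {X Y : C} {n : ℕ} (e : Ext X Y n) :
    e.mapExactFunctor (𝟭 C) = e := by
  induction n generalizing X with
  | zero =>
    obtain ⟨f, rfl⟩ := (Ext.mk₀_bijective X Y).2 e
    exact Ext.mapExactFunctor_mk₀ _ f
  | succ n ih =>
    obtain ⟨S, hS, rfl, e', rfl⟩ := exists_extClass_comp e
    dsimp
    rw [Ext.mapExactFunctor_comp, ih, Ext.mapExactFunctor_extClass]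
    rfl

theorem mapExactFunctor_mapExactFunctor [EnoughProjectives C] (F : C ⥤ D) (G : D ⥤ E)
    [F.Additive] [PreservesFiniteLimits F] [PreservesFiniteColimits F]
    [G.Additive] [PreservesFiniteLimits G] [PreservesFiniteColimits G]
    [PreservesFiniteLimits (F ⋙ G)] [PreservesFiniteColimits (F ⋙ G)]
    {X Y : C} {n : ℕ} (e : Ext X Y n) :
    (e.mapExactFunctor F).mapExactFunctor G = e.mapExactFunctor (F ⋙ G) := by
  induction n generalizing X with
  | zero =>
    obtain ⟨f, rfl⟩ := (Ext.mk₀_bijective X Y).2 e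
    rw [Ext.mapExactFunctor_mk₀, Ext.mapExactFunctor_mk₀, Ext.mapExactFunctor_mk₀]
    rfl
  | succ n ih =>
    obtain ⟨S, hS, rfl, e', rfl⟩ := exists_extClass_comp e
    have key : (hS.extClass.mapExactFunctor F).mapExactFunctor G =
        hS.extClass.mapExactFunctor (F ⋙ G) := by
      rw [Ext.mapExactFunctor_extClass, Ext.mapExactFunctor_extClass]
      exact Ext.mapExactFunctor_extClass G (hS.map_of_exact F)
    dsimp
    rw [Ext.mapExactFunctor_comp, Ext.mapExactFunctor_comp, Ext.mapExactFunctor_comp, ih, key]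

end ExtMap

theorem restrictScalars_exact {R S : Type u} [Ring R] [Ring S] (f : R →+* S) :
    PreservesFiniteLimits (ModuleCat.restrictScalars.{u} f) ∧
      PreservesFiniteColimits (ModuleCat.restrictScalars.{u} f) := by
  refine ((CategoryTheory.Functor.exact_tfae (ModuleCat.restrictScalars.{u} f)).out 1 3).mp ?_
  intro T h
  rw [CategoryTheory.ShortComplex.ShortExact.moduleCat_exact_iff_function_exact] at h ⊢
  exact h

instance restrictScalars_preservesFiniteLimits {R S : Type u} [Ring R] [Ring S] (f : R →+* S) :
    PreservesFiniteLimits (ModuleCat.restrictScalars.{u} f) :=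
  (restrictScalars_exact f).1

section Cohomology

attribute [local instance] LieRing.ofAssociativeRing

variable (k : Type u) [Field k]
variable (g : Type u) [LieRing g] [LieAlgebra k g]
variable {g₁ : Type u} [LieRing g₁] [LieAlgebra k g₁]
variable {g₂ : Type u} [LieRing g₂] [LieAlgebra k g₂]
variable {g₃ : Type u} [LieRing g₃] [LieAlgebra k g₃]

/-- The augmentation `U(g) → k`, the algebra map that kills `g`. -/
def augmentation : UniversalEnvelopingAlgebra k g →ₐ[k] k :=
  UniversalEnvelopingAlgebra.lift k (0 : g →ₗ⁅k⁆ k)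

/-- The algebra map `U(g₁) → U(g₂)` induced by a Lie algebra map `g₁ → g₂`. -/
def envMap (f : g₁ →ₗ⁅k⁆ g₂) :
    UniversalEnvelopingAlgebra k g₁ →ₐ[k] UniversalEnvelopingAlgebra k g₂ :=
  UniversalEnvelopingAlgebra.lift k ((UniversalEnvelopingAlgebra.ι k).comp f)

theorem envMap_id :
    envMap k (LieHom.id : g →ₗ⁅k⁆ g) = AlgHom.id k (UniversalEnvelopingAlgebra k g) := by
  ext x
  simp [envMap]

theorem envMap_comp (f : g₂ →ₗ⁅k⁆ g₃) (f' : g₁ →ₗ⁅k⁆ g₂) :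
    envMap k (f.comp f') = (envMap k f).comp (envMap k f') := by
  ext x
  simp [envMap]

theorem augmentation_comp_envMap (f : g₁ →ₗ⁅k⁆ g₂) :
    (augmentation k g₂).comp (envMap k f) = augmentation k g₁ := by
  ext x
  simp [envMap, augmentation]

/-- The trivial `g`-module `k`, as a module over `U(g)`. -/
def trivialModule : ModuleCat.{u} (UniversalEnvelopingAlgebra k g) :=
  (ModuleCat.restrictScalars (augmentation k g).toRingHom).obj (ModuleCat.of k k)

/-- The Lie algebra cohomology `H^i(g, k) = Ext^i_{U(g)}(k, k)`. -/
abbrev Cohomology (i : ℕ) : Type u :=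
  Ext.{u} (trivialModule k g) (trivialModule k g) i

/-- Restriction of modules along a Lie algebra map `g₁ → g₂`. -/
abbrev restriction (f : g₁ →ₗ⁅k⁆ g₂) :
    ModuleCat.{u} (UniversalEnvelopingAlgebra k g₂) ⥤
      ModuleCat.{u} (UniversalEnvelopingAlgebra k g₁) :=
  ModuleCat.restrictScalars (envMap k f).toRingHom

/-- The restriction of the trivial module is the trivial module (by the identity of `k`). -/
def restrictionTrivialIso (f : g₁ →ₗ⁅k⁆ g₂) :
    (restriction k f).obj (trivialModule k g₂) ≅ trivialModule k g₁ :=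
  ((ModuleCat.restrictScalarsComp'.{u} (envMap k f).toRingHom (augmentation k g₂).toRingHom
    (augmentation k g₁).toRingHom
    (congrArg AlgHom.toRingHom (augmentation_comp_envMap k f)).symm).app (ModuleCat.of k k)).symm

/-- The map `H^i(g₂, k) → H^i(g₁, k)` induced by a Lie algebra map `f : g₁ → g₂`: apply the exact
functor of restriction along `f` and identify the restriction of `k` with `k`. -/
def cohomologyMap (f : g₁ →ₗ⁅k⁆ g₂) (i : ℕ) : Cohomology k g₂ i →ₗ[k] Cohomology k g₁ i where
  toFun x := (Ext.mk₀ (restrictionTrivialIso k f).inv).comp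
    ((x.mapExactFunctor (restriction k f)).comp
      (Ext.mk₀ (restrictionTrivialIso k f).hom) (add_zero i)) (zero_add i)
  map_add' x y := by
    rw [Ext.mapExactFunctor_add, Ext.add_comp, Ext.comp_add]
  map_smul' r x := by
    have : (restriction k f).Linear k := ModuleCat.Algebra.instLinearRestrictScalars (envMap k f)
    rw [Functor.mapExactFunctor_smul, Ext.smul_comp, Ext.comp_smul]
    rfl

theorem cohomologyMap_id (i : ℕ) :
    cohomologyMap k (LieHom.id : g →ₗ⁅k⁆ g) i = LinearMap.id := by
  refine LinearMap.ext fun x => ?_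
  let τ := ModuleCat.restrictScalarsId'.{u} (envMap k (LieHom.id : g →ₗ⁅k⁆ g)).toRingHom
    (congrArg AlgHom.toRingHom (envMap_id k g))
  have h := mapExactFunctor_natTrans τ.hom x
  rw [mapExactFunctor_id] at h
  have hτ : τ.hom.app (trivialModule k g) = (restrictionTrivialIso k LieHom.id).hom := rfl
  rw [hτ] at h
  change (Ext.mk₀ (restrictionTrivialIso k LieHom.id).inv).comp
    ((x.mapExactFunctor (restriction k LieHom.id)).comp
      (Ext.mk₀ (restrictionTrivialIso k LieHom.id).hom) (add_zero i)) (zero_add i) = x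
  refine (congrArg (fun y => (Ext.mk₀ (restrictionTrivialIso k LieHom.id).inv).comp y
    (zero_add i)) h).trans ?_
  refine (Ext.mk₀_comp_mk₀_assoc _ _ _).trans ?_
  rw [Iso.inv_hom_id]
  exact Ext.mk₀_id_comp x

theorem cohomologyMap_comp (f : g₂ →ₗ⁅k⁆ g₃) (f' : g₁ →ₗ⁅k⁆ g₂) (i : ℕ) :
    cohomologyMap k (f.comp f') i = cohomologyMap k f' i ∘ₗ cohomologyMap k f i := by
  refine LinearMap.ext fun x => ?_
  let τ := ModuleCat.restrictScalarsComp'.{u}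
    (envMap k f').toRingHom (envMap k f).toRingHom (envMap k (f.comp f')).toRingHom
    (congrArg AlgHom.toRingHom (envMap_comp k f f'))
  have : PreservesFiniteLimits (restriction k f ⋙ restriction k f') :=
    comp_preservesFiniteLimits _ _
  have : PreservesFiniteColimits (restriction k f ⋙ restriction k f') :=
    comp_preservesFiniteColimits _ _
  have h := mapExactFunctor_natTrans τ.hom x
  rw [← mapExactFunctor_mapExactFunctor] at h
  have hom_eq : (restrictionTrivialIso k (f.comp f')).hom =
      τ.hom.app (trivialModule k g₃) ≫ (restriction k f').map (restrictionTrivialIso k f).hom ≫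
        (restrictionTrivialIso k f').hom := rfl
  have inv_eq : (restrictionTrivialIso k (f.comp f')).inv ≫ τ.hom.app (trivialModule k g₃) =
      (restrictionTrivialIso k f').inv ≫
        (restriction k f').map (restrictionTrivialIso k f).inv := rfl
  change (Ext.mk₀ (restrictionTrivialIso k (f.comp f')).inv).comp
      ((x.mapExactFunctor (restriction k (f.comp f'))).comp
        (Ext.mk₀ (restrictionTrivialIso k (f.comp f')).hom) (add_zero i)) (zero_add i) =
    (Ext.mk₀ (restrictionTrivialIso k f').inv).comp
      ((((Ext.mk₀ (restrictionTrivialIso k f).inv).comp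
        ((x.mapExactFunctor (restriction k f)).comp
          (Ext.mk₀ (restrictionTrivialIso k f).hom) (add_zero i))
            (zero_add i)).mapExactFunctor (restriction k f')).comp
        (Ext.mk₀ (restrictionTrivialIso k f').hom) (add_zero i)) (zero_add i)
  rw [Ext.mapExactFunctor_comp, Ext.mapExactFunctor_comp, Ext.mapExactFunctor_mk₀,
    Ext.mapExactFunctor_mk₀, hom_eq, ← Ext.mk₀_comp_mk₀, ← Ext.mk₀_comp_mk₀,
    ← Ext.comp_assoc_of_second_deg_zero, h]
  simp only [Ext.comp_assoc_of_third_deg_zero]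
  rw [Ext.mk₀_comp_mk₀_assoc, Ext.mk₀_comp_mk₀_assoc, inv_eq]

variable {g} in
/-- If a group `G` acts on `g` by Lie algebra automorphisms, it acts on `H^i(g, k)`: an element `a`
acts by the map induced by the action of `a⁻¹` on `g`. -/
def cohomologyRep {G : Type*} [Group G] (φ : G → (g →ₗ⁅k⁆ g)) (φ_one : φ 1 = LieHom.id)
    (φ_mul : ∀ a b, φ (a * b) = (φ a).comp (φ b)) (i : ℕ) :
    Representation k G (Cohomology k g i) where
  toFun a := cohomologyMap k (φ a⁻¹) i
  map_one' := by rw [inv_one, φ_one, cohomologyMap_id]; rfl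
  map_mul' a b := by rw [mul_inv_rev, φ_mul, cohomologyMap_comp]; rfl

end Cohomology

section Free

open DirectSum

/-- The vector space `V = ℂ^m`. -/
abbrev V (m : ℕ) : Type := Fin m → ℂ

/-- The group `GL(V)`. -/
abbrev GLV (m : ℕ) : Type := LinearMap.GeneralLinearGroup ℂ (V m)

/-- The free Lie algebra `L` on `V = ℂ^m`, generated by the standard basis of `V`. -/
abbrev L (m : ℕ) : Type := FreeLieAlgebra ℂ (Fin m)

/-- The canonical inclusion `V → L`. -/
def inclusion (m : ℕ) : V m →ₗ[ℂ] L m :=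
  Fintype.linearCombination ℂ (FreeLieAlgebra.of ℂ)

/-- The endomorphism of `L` that extends a linear endomorphism of `V`. -/
def freeMap {m : ℕ} (a : V m →ₗ[ℂ] V m) : L m →ₗ⁅ℂ⁆ L m :=
  FreeLieAlgebra.lift ℂ fun j => inclusion m (a (Pi.single j 1))

theorem inclusion_single {m : ℕ} (j : Fin m) :
    inclusion m (Pi.single j 1) = FreeLieAlgebra.of ℂ j := by
  simp [inclusion]

theorem freeMap_inclusion {m : ℕ} (a : V m →ₗ[ℂ] V m) (v : V m) :
    freeMap a (inclusion m v) = inclusion m (a v) := by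
  have h : (freeMap a : L m →ₗ[ℂ] L m) ∘ₗ inclusion m = inclusion m ∘ₗ a := by
    ext j
    simp [inclusion_single, freeMap]
  exact LinearMap.congr_fun h v

theorem freeMap_one (m : ℕ) : freeMap (1 : V m →ₗ[ℂ] V m) = LieHom.id := by
  ext j
  simp [freeMap, inclusion_single]

theorem freeMap_mul {m : ℕ} (a b : V m →ₗ[ℂ] V m) :
    freeMap (a * b) = (freeMap a).comp (freeMap b) := by
  ext j
  rw [LieHom.comp_apply, ← inclusion_single, freeMap_inclusion, freeMap_inclusion,
    freeMap_inclusion]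
  rfl

/-- The Lie algebra `𝔤 = L^{⊕n}`. -/
abbrev 𝔤 (m n : ℕ) : Type := ⨁ _ : Fin n, L m

/-- The action of `S_n` on `𝔤` by permuting the summands: `(σ x)_j = x_{σ⁻¹ j}`. -/
def permAct (m n : ℕ) (σ : Equiv.Perm (Fin n)) : 𝔤 m n →ₗ⁅ℂ⁆ 𝔤 m n where
  toLinearMap := (DirectSum.lequivCongrLeft ℂ σ : (⨁ _ : Fin n, L m) ≃ₗ[ℂ] ⨁ _ : Fin n, L m)
  map_lie' {x y} := by
    refine DFinsupp.ext fun j => ?_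
    exact (DirectSum.lequivCongrLeft_apply ℂ σ ⁅x, y⁆ j).trans
      (DirectSum.bracket_apply (fun _ : Fin n => L m) x y (σ.symm j))

theorem permAct_apply (m n : ℕ) (σ : Equiv.Perm (Fin n)) (x : 𝔤 m n) (j : Fin n) :
    permAct m n σ x j = x (σ⁻¹ j) :=
  DirectSum.lequivCongrLeft_apply ℂ σ x j

/-- The action of `GL(V)` on `𝔤`, through its action on each summand `L`. -/
def glAct (m n : ℕ) (a : GLV m) : 𝔤 m n →ₗ⁅ℂ⁆ 𝔤 m n where
  toLinearMap := DirectSum.lmap fun _ : Fin n => (freeMap (a : V m →ₗ[ℂ] V m) : L m →ₗ[ℂ] L m)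
  map_lie' {x y} := by
    refine DFinsupp.ext fun j => ?_
    exact (congrArg (freeMap (a : V m →ₗ[ℂ] V m))
      (DirectSum.bracket_apply (fun _ : Fin n => L m) x y j)).trans (LieHom.map_lie _ _ _)

theorem glAct_apply (m n : ℕ) (a : GLV m) (x : 𝔤 m n) (j : Fin n) :
    glAct m n a x j = freeMap (a : V m →ₗ[ℂ] V m) (x j) := rfl

/-- The representation of `S_n` on `H^i(𝔤, ℂ)`. -/
def permRep (m n i : ℕ) : Representation ℂ (Equiv.Perm (Fin n)) (Cohomology ℂ (𝔤 m n) i) :=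
  cohomologyRep ℂ (permAct m n)
    (by
      ext x : 1
      refine DFinsupp.ext fun j => ?_
      simp [permAct_apply])
    (fun σ τ => by
      ext x : 1
      refine DFinsupp.ext fun j => ?_
      simp [permAct_apply])
    i

/-- The representation of `GL(V)` on `H^i(𝔤, ℂ)`. -/
def glRep (m n i : ℕ) : Representation ℂ (GLV m) (Cohomology ℂ (𝔤 m n) i) :=
  cohomologyRep ℂ (glAct m n)
    (by
      ext x : 1
      refine DFinsupp.ext fun j => ?_
      simp [glAct_apply, freeMap_one])
    (fun a b => by
      ext x : 1
      refine DFinsupp.ext fun j => ?_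
      simp [glAct_apply, freeMap_mul])
    i

end Free

section Coefficients

open TensorProduct PiTensorProduct

/-- The inclusion `S_i × S_{n-i} → S_n`; the first factor permutes the first `i` letters and the
second factor permutes the remaining ones. -/
def youngHom {i n : ℕ} (hi : i ≤ n) :
    Equiv.Perm (Fin i) × Equiv.Perm (Fin (n - i)) →* Equiv.Perm (Fin n) :=
  (Equiv.permCongrHom
    (finSumFinEquiv.trans (finCongr (Nat.add_sub_of_le hi)))).toMonoidHom.comp
    (Equiv.Perm.sumCongrHom (Fin i) (Fin (n - i)))

variable (k : Type u) [CommRing k]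

/-- The sign representation `ε_i` of `S_i`. -/
def signRep (i : ℕ) : Representation k (Equiv.Perm (Fin i)) k where
  toFun σ := ((Equiv.Perm.sign σ : ℤ) : k) • LinearMap.id
  map_one' := by
    ext
    simp
  map_mul' σ τ := by
    ext
    simp [mul_comm]

section Twist

variable {k} {A : Type u} [AddCommGroup A] [Module k A]

/-- The external tensor product `ρ ⊠ τ` of representations. -/
def extTensor {G H B : Type*} [Group G] [Group H] [AddCommGroup B] [Module k B]
    (ρ : Representation k G A) (τ : Representation k H B) :
    Representation k (G × H) (A ⊗[k] B) :=
  Representation.tprod (ρ.comp (MonoidHom.fst G H)) (τ.comp (MonoidHom.snd G H))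

/-- For a representation `A` of `S_i`, the representation `(A ⊗ ε_i) ⊠ k` of `S_i × S_j`, with
`S_j` acting trivially on `k`. -/
def twistRep {i : ℕ} (ρ : Representation k (Equiv.Perm (Fin i)) A) (j : ℕ) :
    Representation k (Equiv.Perm (Fin i) × Equiv.Perm (Fin j)) ((A ⊗[k] k) ⊗[k] k) :=
  extTensor (ρ.tprod (signRep k i)) (Representation.trivial k (Equiv.Perm (Fin j)) k)

/-- An endomorphism `f` of the representation `A` of `S_i` induces the endomorphism `f ⊗ id ⊗ id`
of `(A ⊗ ε_i) ⊠ k`. -/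
def twistMap {i : ℕ} {ρ : Representation k (Equiv.Perm (Fin i)) A} (f : ρ.IntertwiningMap ρ)
    (j : ℕ) : (twistRep ρ j).IntertwiningMap (twistRep ρ j) where
  toLinearMap := TensorProduct.map (TensorProduct.map f.toLinearMap LinearMap.id) LinearMap.id
  isIntertwining' p := by
    ext x
    have h := LinearMap.congr_fun (f.isIntertwining' p.1) x
    simp only [LinearMap.comp_apply] at h
    simp [twistRep, extTensor, signRep, h]

/-- The representation `Ind_{S_i × S_{n-i}}^{S_n} ((A ⊗ ε_i) ⊠ k)` of `S_n`. -/
def indTwistRep {i n : ℕ} (hi : i ≤ n) (ρ : Representation k (Equiv.Perm (Fin i)) A) :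
    Rep.{u} k (Equiv.Perm (Fin n)) :=
  Rep.ind (youngHom hi) (Rep.of (twistRep ρ (n - i)))

/-- The endomorphism of `Ind_{S_i × S_{n-i}}^{S_n} ((A ⊗ ε_i) ⊠ k)` that an endomorphism of the
representation `A` of `S_i` induces, by functoriality of induction. -/
def indTwistMap {i n : ℕ} (hi : i ≤ n) {ρ : Representation k (Equiv.Perm (Fin i)) A}
    (f : ρ.IntertwiningMap ρ) : indTwistRep hi ρ ⟶ indTwistRep hi ρ :=
  Rep.indMap (youngHom hi) (Rep.ofHom (twistMap f (n - i)))

end Twist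

variable (W : Type u) [AddCommGroup W] [Module k W]

/-- `S_i` acts on `W^{⊗i}` by permuting the tensor factors. -/
def tensorPowerRep (i : ℕ) : Representation k (Equiv.Perm (Fin i)) (⨂[k] _ : Fin i, W) where
  toFun σ := (PiTensorProduct.reindex k (fun _ => W) σ).toLinearMap
  map_one' := by
    ext f
    simp
    rfl
  map_mul' σ τ := by
    ext f
    simp
    rfl

variable {k W} in
/-- The endomorphism `f^{⊗i}` of the representation `W^{⊗i}` of `S_i`. -/
def tensorPowerMap (i : ℕ) (f : W →ₗ[k] W) :
    (tensorPowerRep k W i).IntertwiningMap (tensorPowerRep k W i) where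
  toLinearMap := PiTensorProduct.map fun _ => f
  isIntertwining' σ := by
    ext x
    simp [tensorPowerRep]

/-- The representation `Ind_{S_i × S_{n-i}}^{S_n} ((W^{⊗i} ⊗ ε_i) ⊠ k)` of `S_n`. -/
def indRep {i n : ℕ} (hi : i ≤ n) : Rep.{u} k (Equiv.Perm (Fin n)) :=
  indTwistRep (A := ⨂[k] _ : Fin i, W) hi (tensorPowerRep k W i)

variable {k W} in
/-- The endomorphism of `Ind_{S_i × S_{n-i}}^{S_n} ((W^{⊗i} ⊗ ε_i) ⊠ k)` that an endomorphism `f`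
of `W` induces through `f^{⊗i}`, by functoriality of induction. -/
def indMap {i n : ℕ} (hi : i ≤ n) (f : W →ₗ[k] W) : indRep k W hi ⟶ indRep k W hi :=
  indTwistMap (A := ⨂[k] _ : Fin i, W) hi (tensorPowerMap i f)

/-- The contragredient representation `V^*` of `GL(V)`: `a` acts by `ξ ↦ ξ ∘ a⁻¹`. -/
def dualRep (m : ℕ) : Representation ℂ (GLV m) (Module.Dual ℂ (V m)) :=
  Representation.dual (Units.coeHom (V m →ₗ[ℂ] V m))

end Coefficients

end FreeLieCoh

end

noncomputable section

open CategoryTheory Limits Abelian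

universe u

/-! Write x_{j,b} for the generators of U = U(𝔤), with j a summand and b a basis vector of V.
Generators of distinct summands commute and those of one summand are free, so U is the algebra of
the monoid of n-tuples of words. Let I_t be the left ideal generated by the x_{j,b} with j ≥ t: it
is 0 for t = n and the augmentation ideal for t = 0. Right multiplication by the x_{j,b} gives short
exact sequences 0 → (U/I_{j+1})^m → U/I_{j+1} → U/I_j → 0 (`stepComplex_shortExact`), which play the
role of a Koszul resolution of the trivial module.

A linear form on V placed on one summand is a character of 𝔤 and has a class in H^1. This class is
linear in the character, natural, and of square zero, so products of such classes alternate
(`charProd`). Descending induction on t shows two things together (`TailExtSpec`): Ext^i(U/I_t, ℂ)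
has dimension binom(n-t, i) m^i, and it is spanned by pullbacks of products of characters of
distinct summands j ≥ t. The spanning statement drives the induction: a class pulled back from the
trivial module dies on (U/I_{j+1})^m, because the x_{j,b} have augmentation 0. The long exact
sequence therefore splits into short ones, dimensions add up by Pascal's rule, and the connecting
map is multiplication by coordinate classes of the j-th summand (`step_extClass_comp`). The case t =
0 computes H^i, including its vanishing for i > n.

For i ≤ n, multiplying classes of the first i summands gives (V^*)^{⊗i} → H^i (`powerMap`),
equivariant under S_i × S_{n-i} up to the sign that reordering an alternating product costs.
Frobenius reciprocity extends it to the induced representation. The extension is surjective because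
permutations carry the first i summands to any i distinct ones, and bijective because the cosets
correspond to i-subsets, which bounds the dimension of the source by binom(n, i) m^i. Compatibility
with GL(V) is checked on products of characters. -/

namespace FreeLieCoh

/-! ### Words and tail ideals in the enveloping algebra -/

section Algebra

attribute [local instance] LieRing.ofAssociativeRing

variable (m n : ℕ)

/-- The enveloping algebra of `𝔤`. -/
abbrev Env : Type := UniversalEnvelopingAlgebra ℂ (𝔤 m n)

/-- Tuples of words, a monoid whose algebra is the enveloping algebra of `𝔤`. -/
abbrev Words : Type := Fin n → FreeMonoid (Fin m)

variable {m n}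

/-- The generator of the enveloping algebra given by the `b`-th basis vector of `V` in the
`j`-th summand. -/
def gen (j : Fin n) (b : Fin m) : Env m n :=
  UniversalEnvelopingAlgebra.ι ℂ (DirectSum.of (fun _ : Fin n => L m) j (FreeLieAlgebra.of ℂ b))

theorem gen_commute {j j' : Fin n} (h : j ≠ j') (b b' : Fin m) :
    Commute (gen j b) (gen j' b') := by
  rw [commute_iff_lie_eq, gen, gen, ← LieHom.map_lie,
    DirectSum.lie_of_of_ne (fun _ : Fin n => L m) h, map_zero]

theorem lieHom_ext_gen {A : Type*} [LieRing A] [LieAlgebra ℂ A] {f g : 𝔤 m n →ₗ⁅ℂ⁆ A}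
    (h : ∀ j b, f (DirectSum.of (fun _ : Fin n => L m) j (FreeLieAlgebra.of ℂ b)) =
      g (DirectSum.of (fun _ : Fin n => L m) j (FreeLieAlgebra.of ℂ b))) : f = g := by
  have h' : ∀ j, f.comp (DirectSum.lieAlgebraOf ℂ (Fin n) (fun _ => L m) j) =
      g.comp (DirectSum.lieAlgebraOf ℂ (Fin n) (fun _ => L m) j) :=
    fun j => FreeLieAlgebra.hom_ext fun b => h j b
  have hfg : (f : 𝔤 m n →ₗ[ℂ] A) = (g : 𝔤 m n →ₗ[ℂ] A) := by
    refine DirectSum.linearMap_ext ℂ fun j => LinearMap.ext fun x => ?_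
    exact LieHom.congr_fun (h' j) x
  exact LieHom.ext fun x => LinearMap.congr_fun hfg x

/-- The monoid map from words in the `j`-th summand. -/
def wordHom (j : Fin n) : FreeMonoid (Fin m) →* Env m n := FreeMonoid.lift (gen j)

theorem wordHom_commute : Pairwise fun j j' : Fin n => ∀ x y : FreeMonoid (Fin m),
    Commute (wordHom j x) (wordHom j' y) := by
  intro j j' h x y
  induction x using FreeMonoid.inductionOn with
  | one => simp
  | mul x x' hx hx' => rw [map_mul]; exact hx.mul_left hx'
  | of b =>
    induction y using FreeMonoid.inductionOn with
    | one => simp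
    | mul y y' hy hy' => rw [map_mul]; exact hy.mul_right hy'
    | of c => simpa [wordHom] using gen_commute h b c

/-- The algebra map from the monoid algebra to the enveloping algebra. -/
def ofWords : MonoidAlgebra ℂ (Words m n) →ₐ[ℂ] Env m n :=
  MonoidAlgebra.lift ℂ (Env m n) (Words m n) (MonoidHom.noncommPiCoprod wordHom wordHom_commute)

/-- The Lie algebra map of the `j`-th summand to the monoid algebra. -/
def summandToWords (j : Fin n) : L m →ₗ⁅ℂ⁆ MonoidAlgebra ℂ (Words m n) :=
  ((MonoidAlgebra.mapDomainAlgHom ℂ ℂ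
    (MonoidHom.mulSingle (fun _ : Fin n => FreeMonoid (Fin m)) j) :
      MonoidAlgebra ℂ (FreeMonoid (Fin m)) →ₐ[ℂ] MonoidAlgebra ℂ (Words m n)) :
        MonoidAlgebra ℂ (FreeMonoid (Fin m)) →ₗ⁅ℂ⁆ MonoidAlgebra ℂ (Words m n)).comp
  (FreeLieAlgebra.lift ℂ fun b => MonoidAlgebra.single (FreeMonoid.of b) 1)


theorem summandToWords_of (j : Fin n) (b : Fin m) :
    summandToWords j (FreeLieAlgebra.of ℂ b) =
      MonoidAlgebra.single (Pi.mulSingle j (FreeMonoid.of b) : Words m n) (1 : ℂ) := by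
  simp [summandToWords]

theorem summandToWords_commute : Pairwise fun j j' : Fin n => ∀ x y : L m,
    ⁅summandToWords j x, summandToWords j' y⁆ = 0 := by
  intro j j' h x y
  rw [← commute_iff_lie_eq]
  simp only [summandToWords, LieHom.comp_apply, AlgHom.coe_toLieHom]
  generalize FreeLieAlgebra.lift ℂ
    (fun b => MonoidAlgebra.single (FreeMonoid.of b) (1 : ℂ)) x = p
  generalize FreeLieAlgebra.lift ℂ
    (fun b => MonoidAlgebra.single (FreeMonoid.of b) (1 : ℂ)) y = q
  induction p using MonoidAlgebra.induction_linear with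
  | zero => rw [map_zero]; exact Commute.zero_left _
  | add p p' hp hp' => rw [map_add]; exact hp.add_left hp'
  | single u r =>
    induction q using MonoidAlgebra.induction_linear with
    | zero => rw [map_zero]; exact Commute.zero_right _
    | add q q' hq hq' => rw [map_add]; exact hq.add_right hq'
    | single u' r' =>
      have := (Pi.mulSingle_commute (f := fun _ : Fin n => FreeMonoid (Fin m)) h u u').eq
      simp [Commute, SemiconjBy, MonoidAlgebra.single_mul_single, this, mul_comm]

/-- The algebra map from the enveloping algebra to the monoid algebra. -/
def toWords : Env m n →ₐ[ℂ] MonoidAlgebra ℂ (Words m n) :=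
  UniversalEnvelopingAlgebra.lift ℂ
    (DirectSum.toLieAlgebra (L := fun _ : Fin n => L m) _ summandToWords summandToWords_commute)

theorem toWords_gen (j : Fin n) (b : Fin m) :
    toWords (gen j b) = MonoidAlgebra.single (Pi.mulSingle j (FreeMonoid.of b)) 1 := by
  rw [gen, toWords, UniversalEnvelopingAlgebra.lift_ι_apply]
  exact (DirectSum.toModule_lof ℂ j _).trans (summandToWords_of j b)

theorem ofWords_single (w : Words m n) (r : ℂ) : ofWords (MonoidAlgebra.single w r) =
    r • MonoidHom.noncommPiCoprod wordHom wordHom_commute w := by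
  simp [ofWords]

theorem ofWords_gen (j : Fin n) (b : Fin m) :
    ofWords (MonoidAlgebra.single (Pi.mulSingle j (FreeMonoid.of b) : Words m n) 1) = gen j b := by
  rw [ofWords_single, MonoidHom.noncommPiCoprod_mulSingle]
  simp [wordHom]

/-- Both sides agree on the generators of `𝔤`. This one-sided inverse is enough: it makes `toWords`
injective, so elements of the enveloping algebra can be tested on coefficients of words. -/
theorem ofWords_comp_toWords : ofWords.comp toWords = AlgHom.id ℂ (Env m n) := by
  apply UniversalEnvelopingAlgebra.hom_ext
  refine lieHom_ext_gen fun j b => ?_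
  exact (congrArg ofWords (toWords_gen j b)).trans (ofWords_gen j b)

theorem ofWords_toWords (r : Env m n) : ofWords (toWords r) = r :=
  DFunLike.congr_fun ofWords_comp_toWords r

theorem freeMonoid_exists_eq_mul_of {X : Type*} {x : FreeMonoid X} (hx : x ≠ 1) :
    ∃ y b, x = y * FreeMonoid.of b := by
  induction x using FreeMonoid.inductionOn' with
  | one => exact absurd rfl hx
  | of_mul b x ih =>
    by_cases h : x = 1
    · exact ⟨1, b, by simp [h]⟩
    · obtain ⟨y, b', rfl⟩ := ih h
      exact ⟨FreeMonoid.of b * y, b', (mul_assoc _ _ _).symm⟩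

theorem freeMonoid_mul_of_inj {X : Type*} {x y : FreeMonoid X} {a b : X}
    (h : x * FreeMonoid.of a = y * FreeMonoid.of b) : a = b := by
  have h' := congrArg (fun z => z.toList.getLast?) h
  simpa using h'

theorem exists_eq_mul_mulSingle {w : Words m n} {j : Fin n} (h : w j ≠ 1) :
    ∃ (w' : Words m n) (b : Fin m), w = w' * Pi.mulSingle j (FreeMonoid.of b) := by
  obtain ⟨y, b, hy⟩ := freeMonoid_exists_eq_mul_of h
  refine ⟨Function.update w j y, b, funext fun l => ?_⟩
  obtain rfl | hl := eq_or_ne l j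
  · simpa using hy
  · simp [hl]

/-- The left ideal generated by the summands of index at least `t`. -/
def tailIdeal (t : Fin (n + 1)) : Submodule (Env m n) (Env m n) :=
  Submodule.span _ {x | ∃ (j : Fin n) (b : Fin m), t ≤ j.castSucc ∧ x = gen j b}

theorem gen_mem_tailIdeal {t : Fin (n + 1)} {j : Fin n} (h : t ≤ j.castSucc) (b : Fin m) :
    gen j b ∈ tailIdeal (m := m) t :=
  Submodule.subset_span ⟨j, b, h, rfl⟩

theorem tailIdeal_antitone {s t : Fin (n + 1)} (h : s ≤ t) :
    tailIdeal (m := m) t ≤ tailIdeal s :=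
  Submodule.span_mono fun _ ⟨j, b, hj, e⟩ => ⟨j, b, h.trans hj, e⟩

theorem tailIdeal_last : tailIdeal (m := m) (Fin.last n) = ⊥ := by
  rw [tailIdeal, Submodule.span_eq_bot]
  rintro _ ⟨j, b, h, -⟩
  exact absurd h (not_le.2 j.castSucc_lt_last)

/-- Generators of the later summands commute with `gen j b`, so right multiplication by it preserves
their left ideal. This is what makes `mulGen` descend to the quotient. -/
theorem mul_gen_mem_tailIdeal {j : Fin n} (b : Fin m) {r : Env m n}
    (hr : r ∈ tailIdeal (m := m) j.succ) : r * gen j b ∈ tailIdeal (m := m) j.succ := by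
  induction hr using Submodule.span_induction with
  | mem x hx =>
    obtain ⟨j', b', h, rfl⟩ := hx
    have hne : j' ≠ j := by
      rintro rfl
      exact absurd h (not_le.2 (Fin.castSucc_lt_succ))
    rw [(gen_commute hne b' b).eq]
    exact Submodule.smul_mem _ _ (gen_mem_tailIdeal h b')
  | zero => simp
  | add x y _ _ hx hy => rw [add_mul]; exact add_mem hx hy
  | smul a x _ hx => rw [smul_mul_assoc]; exact Submodule.smul_mem _ _ hx

theorem exists_sub_mem_tailIdeal_succ {j : Fin n} {r : Env m n}
    (hr : r ∈ tailIdeal (m := m) j.castSucc) :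
    ∃ s : Fin m → Env m n, r - ∑ b, s b * gen j b ∈ tailIdeal (m := m) j.succ := by
  induction hr using Submodule.span_induction with
  | mem x hx =>
    obtain ⟨j', b', h, rfl⟩ := hx
    obtain rfl | hne := eq_or_ne j j'
    · refine ⟨Pi.single b' 1, ?_⟩
      rw [Finset.sum_eq_single b' (fun b _ hb => by simp [hb]) (by simp)]
      simp
    · refine ⟨0, ?_⟩
      have h' : j.succ ≤ j'.castSucc :=
        Fin.succ_le_castSucc_iff.2 (lt_of_le_of_ne (Fin.castSucc_le_castSucc_iff.1 h) hne)
      simpa using gen_mem_tailIdeal h' b'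
  | zero => exact ⟨0, by simp⟩
  | add x y _ _ hx hy =>
    obtain ⟨s, hs⟩ := hx
    obtain ⟨s', hs'⟩ := hy
    refine ⟨s + s', ?_⟩
    convert add_mem hs hs' using 1
    simp only [Pi.add_apply, add_mul, Finset.sum_add_distrib]
    abel
  | smul a x _ hx =>
    obtain ⟨s, hs⟩ := hx
    refine ⟨a • s, ?_⟩
    convert Submodule.smul_mem _ a hs using 1
    simp [mul_sub, Finset.mul_sum, mul_assoc]

/-- The tail ideal is spanned by the monomials containing a letter of index at least `t`: since
summands commute, the last letter of that component can be split off on the right. -/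
theorem mem_tailIdeal_iff {t : Fin (n + 1)} {r : Env m n} :
    r ∈ tailIdeal (m := m) t ↔
      ∀ w : Words m n, (∀ j : Fin n, t ≤ j.castSucc → w j = 1) → (toWords r).coeff w = 0 := by
  constructor
  · intro hr
    obtain ⟨f, hf, rfl⟩ := (Submodule.mem_span_set).1 hr
    intro w hw
    rw [Finsupp.sum, map_sum, MonoidAlgebra.coeff_sum, Finset.sum_apply']
    have : ∀ x ∈ f.support, (toWords (f x • x)).coeff w = 0 := by
      intro x hx
      obtain ⟨j, b, h, rfl⟩ := hf hx
      rw [smul_eq_mul, map_mul, toWords_gen]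
      -- A word ending with a letter in component `j` is nontrivial there, so it cannot be `w`.
      refine MonoidAlgebra.coeff_mul_single_of_forall_mul_ne _ _ fun d hd => ?_
      have := congrFun hd j
      rw [hw j h] at this
      simp at this
    exact Finset.sum_eq_zero this
  · intro h
    rw [← ofWords_toWords r]
    rw [← (toWords r).sum_coeff_single, Finsupp.sum, map_sum]
    refine Submodule.sum_mem _ fun w hw => ?_
    have : ¬ ∀ j : Fin n, t ≤ j.castSucc → w j = 1 := fun h' =>
      (Finsupp.mem_support_iff.1 hw) (h w h')
    push Not at this
    obtain ⟨j, hj, hwj⟩ := this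
    obtain ⟨w', b, rfl⟩ := exists_eq_mul_mulSingle hwj
    rw [← mul_one ((toWords r).coeff _), ← MonoidAlgebra.single_mul_single, map_mul, ofWords_gen]
    exact Submodule.smul_mem _ _ (gen_mem_tailIdeal hj b)

/-- Freeness within one summand: the last letter of a word determines `b`, so the coefficient of the
sum at `w` followed by the letter `b` is the coefficient of `s b` at `w`. -/
theorem mem_tailIdeal_of_sum_mem {j : Fin n} {s : Fin m → Env m n}
    (h : ∑ b, s b * gen j b ∈ tailIdeal (m := m) j.succ) (b : Fin m) :
    s b ∈ tailIdeal (m := m) j.succ := by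
  rw [mem_tailIdeal_iff] at h ⊢
  intro w hw
  have h1 := h (w * Pi.mulSingle j (FreeMonoid.of b)) (fun j' hj' => by
    have hne : j' ≠ j := by
      rintro rfl
      exact absurd hj' (not_le.2 (Fin.castSucc_lt_succ))
    simp [hw j' hj', hne])
  rw [map_sum] at h1
  have h2 : ∀ b', (toWords (s b' * gen j b')).coeff (w * Pi.mulSingle j (FreeMonoid.of b)) =
      if b' = b then (toWords (s b)).coeff w else 0 := by
    intro b'
    rw [map_mul toWords, toWords_gen]
    split_ifs with hb
    · subst hb
      rw [MonoidAlgebra.coeff_mul_single_eq_coeff_mul w, mul_one]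
      exact fun w' _ => mul_left_inj _
    · refine MonoidAlgebra.coeff_mul_single_of_forall_mul_ne _ _ fun d hd => hb ?_
      have := congrFun hd j
      simp only [Pi.mul_apply, Pi.mulSingle_eq_same] at this
      exact freeMonoid_mul_of_inj this
  rw [MonoidAlgebra.coeff_sum, Finset.sum_apply', Finset.sum_congr rfl fun b' _ => h2 b'] at h1
  simpa using h1

theorem augmentation_gen (j : Fin n) (b : Fin m) : augmentation ℂ (𝔤 m n) (gen j b) = 0 := by
  rw [gen, augmentation, UniversalEnvelopingAlgebra.lift_ι_apply]
  rfl

theorem tailIdeal_le_ker {A : Type*} [Ring A] [Algebra ℂ A] (f : Env m n →ₐ[ℂ] A)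
    {t : Fin (n + 1)} (hf : ∀ (j : Fin n) (b : Fin m), t ≤ j.castSucc → f (gen j b) = 0)
    {r : Env m n} (hr : r ∈ tailIdeal (m := m) t) : f r = 0 := by
  have : tailIdeal (m := m) t ≤ RingHom.ker f := by
    refine Submodule.span_le.2 ?_
    rintro _ ⟨j, b, h, rfl⟩
    exact hf j b h
  exact this hr

theorem mem_tailIdeal_zero_iff {r : Env m n} :
    r ∈ tailIdeal (m := m) (n := n) 0 ↔ augmentation ℂ (𝔤 m n) r = 0 := by
  refine ⟨tailIdeal_le_ker _ fun j b _ => augmentation_gen j b, fun h => ?_⟩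
  -- Subtracting the constant term lands in the ideal; applying the augmentation then forces that
  -- term to vanish.
  set c := (toWords r).coeff 1
  have hr : r - algebraMap ℂ _ c ∈ tailIdeal (m := m) (n := n) 0 := by
    rw [mem_tailIdeal_iff]
    intro w hw
    obtain rfl : w = 1 := funext fun j => hw j (Fin.zero_le _)
    simp [c]
  have hc := tailIdeal_le_ker (augmentation ℂ (𝔤 m n)) (fun j b _ => augmentation_gen j b) hr
  rw [map_sub, h, AlgHom.commutes, zero_sub, neg_eq_zero] at hc
  simpa [show c = 0 from hc] using hr

end Algebra

/-! ### Degree-one classes of characters and their products -/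

section CharClass

attribute [local instance] LieRing.ofAssociativeRing

open Polynomial

variable (k : Type u) [Field k]
variable (g : Type u) [LieRing g] [LieAlgebra k g]
variable {g₁ : Type u} [LieRing g₁] [LieAlgebra k g₁]
variable {g₂ : Type u} [LieRing g₂] [LieAlgebra k g₂]

/-- The space of characters of a Lie algebra: the linear forms that vanish on brackets. -/
def charSpace : Submodule k (Module.Dual k g) where
  carrier := {ξ | ∀ x y : g, ξ ⁅x, y⁆ = 0}
  add_mem' h h' x y := by simp [h x y, h' x y]
  zero_mem' _ _ := rfl
  smul_mem' a ξ h x y := by simp [h x y]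

variable {k g}

/-- The algebra map `U(g) → k[X]` that sends `x` in `g` to `ξ(x) X`. -/
def polyMap (ξ : charSpace k g) : UniversalEnvelopingAlgebra k g →ₐ[k] k[X] :=
  UniversalEnvelopingAlgebra.lift k
    { toLinearMap := (LinearMap.toSpanSingleton k k[X] X) ∘ₗ (ξ : Module.Dual k g)
      map_lie' := fun {x y} => by
        rw [LieRing.of_associative_ring_bracket, mul_comm, sub_self]
        simp [ξ.2 x y] }

theorem polyMap_ι (ξ : charSpace k g) (x : g) :
    polyMap ξ (UniversalEnvelopingAlgebra.ι k x) = (ξ : Module.Dual k g) x • (X : k[X]) :=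
  UniversalEnvelopingAlgebra.lift_ι_apply k _ x

theorem coeff_zero_polyMap (ξ : charSpace k g) (r : UniversalEnvelopingAlgebra k g) :
    (polyMap ξ r).coeff 0 = augmentation k g r := by
  have h : (Polynomial.aeval (0 : k)).comp (polyMap ξ) = augmentation k g := by
    apply UniversalEnvelopingAlgebra.hom_ext
    ext x
    have h1 : augmentation k g (UniversalEnvelopingAlgebra.ι k x) = 0 :=
      UniversalEnvelopingAlgebra.lift_ι_apply k _ x
    have h2 : Polynomial.aeval (0 : k) (polyMap ξ (UniversalEnvelopingAlgebra.ι k x)) = 0 := by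
      rw [polyMap_ι]; simp
    exact h2.trans h1.symm
  rw [← h, coeff_zero_eq_aeval_zero]
  rfl

/-- The restriction of a character along a Lie algebra map. -/
def charComap (f : g₁ →ₗ⁅k⁆ g₂) : charSpace k g₂ →ₗ[k] charSpace k g₁ :=
  ((f : g₁ →ₗ[k] g₂).dualMap ∘ₗ (charSpace k g₂).subtype).codRestrict _ fun ξ x y => by
    simpa using ξ.2 (f x) (f y)

theorem charComap_apply (f : g₁ →ₗ⁅k⁆ g₂) (ξ : charSpace k g₂) (x : g₁) :
    (charComap f ξ : Module.Dual k g₁) x = (ξ : Module.Dual k g₂) (f x) := rfl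

theorem polyMap_comp_envMap (f : g₁ →ₗ⁅k⁆ g₂) (ξ : charSpace k g₂) :
    (polyMap ξ).comp (envMap k f) = polyMap (charComap f ξ) := by
  apply UniversalEnvelopingAlgebra.hom_ext
  ext1 x
  have h1 : envMap k f (UniversalEnvelopingAlgebra.ι k x) = UniversalEnvelopingAlgebra.ι k (f x) :=
    UniversalEnvelopingAlgebra.lift_ι_apply k _ x
  have h2 : polyMap ξ (envMap k f (UniversalEnvelopingAlgebra.ι k x)) =
      polyMap (charComap f ξ) (UniversalEnvelopingAlgebra.ι k x) := by
    rw [h1, polyMap_ι, polyMap_ι, charComap_apply]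
  exact h2

/-- A derivation `U(g) → k` that vanishes on `g` is zero. -/
theorem derivation_eq_zero (D : UniversalEnvelopingAlgebra k g →ₗ[k] k)
    (hD : ∀ x y, D (x * y) = augmentation k g x * D y + D x * augmentation k g y)
    (h : ∀ x : g, D (UniversalEnvelopingAlgebra.ι k x) = 0) : D = 0 := by
  have hD1 : D 1 = 0 := by simpa using hD 1 1
  -- A derivation is the infinitesimal part of an algebra map to the dual numbers, and such a map is
  -- determined on `g`.
  let F : UniversalEnvelopingAlgebra k g →ₐ[k] TrivSqZeroExt k k :=
    AlgHom.ofLinearMap ((TrivSqZeroExt.inlAlgHom k k k).toLinearMap ∘ₗ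
      (augmentation k g).toLinearMap + TrivSqZeroExt.inrHom k k ∘ₗ D)
      (by simp [hD1]) (fun x y => by
        ext
        · simp
        · simp [hD, mul_comm])
  have hF : F = (TrivSqZeroExt.inlAlgHom k k k).comp (augmentation k g) := by
    apply UniversalEnvelopingAlgebra.hom_ext
    ext1 x
    change F (UniversalEnvelopingAlgebra.ι k x) = TrivSqZeroExt.inlAlgHom k k k
      (augmentation k g (UniversalEnvelopingAlgebra.ι k x))
    simp only [F, AlgHom.ofLinearMap_apply, LinearMap.add_apply, LinearMap.comp_apply, h, map_zero,
      add_zero, AlgHom.toLinearMap_apply]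
  ext r
  have := congrArg TrivSqZeroExt.snd (DFunLike.congr_fun hF r)
  simpa [F] using this

/-- The coefficient of `X` in `polyMap ξ r`, as a function of `r`. -/
def coeffOne (ξ : charSpace k g) : UniversalEnvelopingAlgebra k g →ₗ[k] k :=
  Polynomial.lcoeff k 1 ∘ₗ (polyMap ξ).toLinearMap

theorem coeffOne_apply (ξ : charSpace k g) (r : UniversalEnvelopingAlgebra k g) :
    coeffOne ξ r = (polyMap ξ r).coeff 1 := rfl

theorem coeffOne_mul (ξ : charSpace k g) (x y : UniversalEnvelopingAlgebra k g) :
    coeffOne ξ (x * y) = augmentation k g x * coeffOne ξ y + coeffOne ξ x * augmentation k g y := by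
  simp only [coeffOne_apply, map_mul, mul_coeff_one, coeff_zero_polyMap]

theorem coeffOne_ι (ξ : charSpace k g) (x : g) :
    coeffOne ξ (UniversalEnvelopingAlgebra.ι k x) = (ξ : Module.Dual k g) x := by
  rw [coeffOne_apply, polyMap_ι]
  simp

/-- `polyMap` is not additive in the character, but its linear coefficient is a derivation along the
augmentation, hence determined on `g`, where additivity is clear. -/
theorem coeffOne_add (ξ η : charSpace k g) : coeffOne (ξ + η) = coeffOne ξ + coeffOne η := by
  rw [← sub_eq_zero]
  refine derivation_eq_zero _ (fun x y => ?_) fun x => ?_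
  · simp only [LinearMap.sub_apply, LinearMap.add_apply, coeffOne_mul]
    ring
  · simp only [LinearMap.sub_apply, LinearMap.add_apply, coeffOne_ι]
    simp

theorem coeffOne_smul (a : k) (ξ : charSpace k g) : coeffOne (a • ξ) = a • coeffOne ξ := by
  rw [← sub_eq_zero]
  refine derivation_eq_zero _ (fun x y => ?_) fun x => ?_
  · simp only [LinearMap.sub_apply, LinearMap.smul_apply, coeffOne_mul, smul_eq_mul]
    ring
  · simp only [LinearMap.sub_apply, LinearMap.smul_apply, coeffOne_ι]
    simp

/-- `k[X]` as a `U(g)`-module on which `x` in `g` acts by `ξ(x) X`. -/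
def polyModule (ξ : charSpace k g) : ModuleCat.{u} (UniversalEnvelopingAlgebra k g) :=
  (ModuleCat.restrictScalars (polyMap ξ).toRingHom).obj (ModuleCat.of k[X] k[X])

/-- Multiplication by `X`. -/
def polyMulX (ξ : charSpace k g) : polyModule ξ ⟶ polyModule ξ :=
  (ModuleCat.restrictScalars (polyMap ξ).toRingHom).map
    (ModuleCat.ofHom (LinearMap.toSpanSingleton k[X] k[X] X))

/-- Evaluation at zero. -/
def polyEval (ξ : charSpace k g) : polyModule ξ ⟶ trivialModule k g :=
  ModuleCat.ofHom (X := polyModule ξ) (Y := trivialModule k g)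
    { toFun := fun p : k[X] => p.coeff 0
      map_add' := fun p q : k[X] => coeff_add p q 0
      map_smul' := fun r (p : k[X]) => by
        change (polyMap ξ r * p).coeff 0 = augmentation k g r * p.coeff 0
        rw [mul_coeff_zero, coeff_zero_polyMap] }

/-- The sequence `k[X] → k[X] → k` of `U(g)`-modules. -/
abbrev polyComplex (ξ : charSpace k g) : ShortComplex (ModuleCat.{u} (UniversalEnvelopingAlgebra k g)) :=
  ShortComplex.mk (polyMulX ξ) (polyEval ξ) (by
    ext p
    exact mul_coeff_zero (p : k[X]) X |>.trans (by rw [coeff_X_zero, mul_zero]; rfl))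

theorem polyComplex_shortExact (ξ : charSpace k g) : (polyComplex ξ).ShortExact where
  exact := by
    rw [ShortComplex.moduleCat_exact_iff]
    intro (p : k[X]) (hp : p.coeff 0 = 0)
    have h : divX p * X = p := by simpa [hp] using divX_mul_X_add p
    exact ⟨(divX p : k[X]), h⟩
  mono_f := by
    have h : Function.Injective fun p : k[X] => p * X := mul_left_injective₀ X_ne_zero
    exact (ModuleCat.mono_iff_injective _).2 h
  epi_g := (ModuleCat.epi_iff_surjective _).2 fun a => ⟨C (R := k) a, coeff_C_zero (R := k)⟩

variable (k g) in
/-- The augmentation as a map of `U(g)`-modules. -/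
def augHom : ModuleCat.of (UniversalEnvelopingAlgebra k g) (UniversalEnvelopingAlgebra k g) ⟶
    trivialModule k g :=
  ModuleCat.ofHom (Y := trivialModule k g)
    { toFun := fun r => (augmentation k g r : k)
      map_add' := fun r s => map_add (augmentation k g) r s
      map_smul' := fun r s => map_mul (augmentation k g) r s }

variable (k g) in
/-- The augmentation ideal. -/
abbrev augIdeal : Submodule (UniversalEnvelopingAlgebra k g) (UniversalEnvelopingAlgebra k g) :=
  RingHom.ker (augmentation k g)

variable (k g) in
/-- The sequence `I → U(g) → k` where `I` is the augmentation ideal. -/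
abbrev augComplex : ShortComplex (ModuleCat.{u} (UniversalEnvelopingAlgebra k g)) :=
  ShortComplex.mk (ModuleCat.ofHom (augIdeal k g).subtype) (augHom k g) (by
    ext r
    exact r.2)

variable (k g) in
theorem augComplex_shortExact : (augComplex k g).ShortExact where
  exact := by
    rw [ShortComplex.moduleCat_exact_iff]
    intro r hr
    exact ⟨(⟨r, hr⟩ : augIdeal k g), rfl⟩
  mono_f := (ModuleCat.mono_iff_injective _).2 Subtype.val_injective
  epi_g := (ModuleCat.epi_iff_surjective _).2 fun (a : k) =>
    ⟨algebraMap k (UniversalEnvelopingAlgebra k g) a, (augmentation k g).commutes a⟩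

/-- The restriction of `coeffOne` to the augmentation ideal is a map of `U(g)`-modules. -/
def coeffOneHom : charSpace k g →ₗ[k]
    (ModuleCat.of (UniversalEnvelopingAlgebra k g) (augIdeal k g) ⟶ trivialModule k g) where
  toFun ξ := ModuleCat.ofHom (Y := trivialModule k g)
    { toFun := fun r => (coeffOne ξ r : k)
      map_add' := fun r s => map_add (coeffOne ξ) r.1 s.1
      map_smul' := fun r s => by
        refine (coeffOne_mul ξ r s.1).trans ?_
        rw [show augmentation k g s.1 = 0 from s.2, mul_zero, add_zero]
        rfl }
  map_add' ξ η := by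
    ext r
    exact LinearMap.congr_fun (coeffOne_add ξ η) r.1
  map_smul' a ξ := by
    ext r
    refine (LinearMap.congr_fun (coeffOne_smul a ξ) r.1).trans ?_
    change a * coeffOne ξ r.1 = augmentation k g (algebraMap k _ a) * coeffOne ξ r.1
    rw [AlgHom.commutes]
    rfl

/-- The class in `H^1(g, k)` of a character. -/
def charClass : charSpace k g →ₗ[k] Cohomology k g 1 :=
  Ext.precompOfLinear (augComplex_shortExact k g).extClass k (trivialModule k g) (add_zero 1) ∘ₗ
    Ext.linearEquiv₀.symm.toLinearMap ∘ₗ coeffOneHom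

theorem divX_polyMap_mul_X (ξ : charSpace k g) {r : UniversalEnvelopingAlgebra k g}
    (hr : r ∈ augIdeal k g) : divX (polyMap ξ r) * X = polyMap ξ r := by
  have h : (polyMap ξ r).coeff 0 = 0 := (coeff_zero_polyMap ξ r).trans hr
  simpa [h] using divX_mul_X_add (polyMap ξ r)

/-- `polyMap` followed by division by `X` on the augmentation ideal maps one extension to the other.
The definition through the augmentation ideal gives linearity in `ξ`; the form through `k[X]` gives
naturality and square zero. -/
theorem charClass_eq (ξ : charSpace k g) :
    charClass ξ = (polyComplex_shortExact ξ).extClass.comp (Ext.mk₀ (polyEval ξ)) (add_zero 1) := by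
  let f : augComplex k g ⟶ polyComplex ξ :=
    { τ₁ := ModuleCat.ofHom (Y := polyModule ξ)
        { toFun := fun r => (divX (polyMap ξ r) : k[X])
          map_add' := fun r s => by
            change divX (polyMap ξ (r.1 + s.1)) = _
            rw [map_add, divX_add]
            rfl
          map_smul' := fun r s => by
            change divX (polyMap ξ (r * s.1)) = polyMap ξ r * divX (polyMap ξ s.1)
            refine mul_right_cancel₀ (X_ne_zero : (X : k[X]) ≠ 0) ?_
            rw [mul_assoc, divX_polyMap_mul_X ξ s.2,
              divX_polyMap_mul_X ξ (r := r * s.1) ((augIdeal k g).smul_mem r s.2), map_mul] }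
      τ₂ := ModuleCat.ofHom (Y := polyModule ξ)
        { toFun := fun r => (polyMap ξ r : k[X])
          map_add' := fun r s => map_add (polyMap ξ) r s
          map_smul' := fun r s => map_mul (polyMap ξ) r s }
      τ₃ := 𝟙 _
      comm₁₂ := by
        ext r
        exact (divX_polyMap_mul_X ξ r.2)
      comm₂₃ := by
        refine ModuleCat.hom_ext (LinearMap.ext fun r => ?_)
        exact coeff_zero_polyMap ξ r }
  have h := ShortComplex.ShortExact.extClass_naturality (augComplex_shortExact k g)
    (polyComplex_shortExact ξ) f
  have hf : coeffOneHom ξ = f.τ₁ ≫ polyEval ξ := by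
    ext r
    exact (coeff_divX (p := polyMap ξ r.1) (n := 0)).symm
  change (augComplex_shortExact k g).extClass.comp (Ext.mk₀ (coeffOneHom ξ)) (add_zero 1) = _
  rw [hf, ← Ext.mk₀_comp_mk₀, ← Ext.comp_assoc_of_third_deg_zero]
  refine (congrArg (fun y => Ext.comp y (Ext.mk₀ (polyEval ξ)) (add_zero 1)) h).trans ?_
  exact congrArg (fun y => Ext.comp y (Ext.mk₀ (polyEval ξ)) (add_zero 1)) (Ext.mk₀_id_comp _)

/-- In the product of two copies of the `k[X]` form, the middle factor is the extension class pulled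
back along its own epimorphism `polyEval ξ`, which is zero. -/
theorem charClass_comp_self (ξ : charSpace k g) :
    (charClass ξ).comp (charClass ξ) (show 1 + 1 = 2 from rfl) = 0 := by
  have h : (Ext.mk₀ (polyEval ξ)).comp (polyComplex_shortExact ξ).extClass (zero_add 1) = 0 :=
    (polyComplex_shortExact ξ).comp_extClass
  conv_lhs => rw [charClass_eq]
  rw [Ext.comp_assoc (a₂₃ := 1) _ _ _ (add_zero 1) (zero_add 1) rfl]
  refine (congrArg (fun y => Ext.comp _ y rfl) ?_).trans (Ext.comp_zero _ _ _ _ _)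
  refine (Ext.comp_assoc_of_third_deg_zero _ _ _ _).symm.trans ?_
  exact (congrArg (fun y => Ext.comp y (Ext.mk₀ (polyEval ξ)) (add_zero 1)) h).trans
    (Ext.zero_comp _ _ _ _ _)

variable (k) in
theorem cohomologyMap_apply (f : g₁ →ₗ⁅k⁆ g₂) (i : ℕ) (x : Cohomology k g₂ i) :
    cohomologyMap k f i x = (Ext.mk₀ (restrictionTrivialIso k f).inv).comp
    ((x.mapExactFunctor (restriction k f)).comp
      (Ext.mk₀ (restrictionTrivialIso k f).hom) (add_zero i)) (zero_add i) := rfl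

/-- The two comparison isomorphisms that meet between the factors cancel. -/
theorem cohomologyMap_mul (f : g₁ →ₗ⁅k⁆ g₂) {i j l : ℕ} (h : i + j = l)
    (x : Cohomology k g₂ i) (y : Cohomology k g₂ j) :
    cohomologyMap k f l (x.comp y h) =
      (cohomologyMap k f i x).comp (cohomologyMap k f j y) h := by
  have hid : ∀ z : Ext ((restriction k f).obj (trivialModule k g₂)) (trivialModule k g₁) j,
      (Ext.mk₀ (restrictionTrivialIso k f).hom).comp
        ((Ext.mk₀ (restrictionTrivialIso k f).inv).comp z (zero_add j)) (zero_add j) = z := by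
    intro z
    rw [Ext.mk₀_comp_mk₀_assoc, Iso.hom_inv_id, Ext.mk₀_id_comp]
  simp only [cohomologyMap_apply]
  rw [Ext.mapExactFunctor_comp]
  rw [Ext.comp_assoc (a₂₃ := l) _ _ _ (zero_add i) (by lia) (by lia)]
  rw [Ext.comp_assoc (a₂₃ := j) _ _ _ (add_zero i) (by lia) (by lia), hid]
  rw [Ext.comp_assoc_of_third_deg_zero]

theorem cohomologyMap_one (f : g₁ →ₗ⁅k⁆ g₂) :
    cohomologyMap k f 0 (Ext.mk₀ (𝟙 _)) = Ext.mk₀ (𝟙 _) := by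
  rw [cohomologyMap_apply, Ext.mapExactFunctor_mk₀, CategoryTheory.Functor.map_id, Ext.mk₀_id_comp,
    Ext.mk₀_comp_mk₀, Iso.inv_hom_id]

theorem cohomologyMap_charClass (f : g₁ →ₗ⁅k⁆ g₂) (ξ : charSpace k g₂) :
    cohomologyMap k f 1 (charClass ξ) = charClass (charComap f ξ) := by
  have hp : ∀ r, polyMap ξ (envMap k f r) = polyMap (charComap f ξ) r :=
    DFunLike.congr_fun (polyMap_comp_envMap f ξ)
  -- The identity of `k[X]` identifies the restricted extension with that of the restricted
  -- character.
  let τ : (restriction k f).obj (polyModule ξ) ⟶ polyModule (charComap f ξ) :=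
    ModuleCat.ofHom (X := (restriction k f).obj (polyModule ξ)) (Y := polyModule (charComap f ξ))
      { toFun := fun p : k[X] => (p : k[X])
        map_add' := fun _ _ => rfl
        map_smul' := fun r (p : k[X]) => by
          change polyMap ξ (envMap k f r) * p = polyMap (charComap f ξ) r * p
          rw [hp] }
  let F : (polyComplex ξ).map (restriction k f) ⟶ polyComplex (charComap f ξ) :=
    { τ₁ := τ
      τ₂ := τ
      τ₃ := (restrictionTrivialIso k f).hom
      comm₁₂ := ModuleCat.hom_ext (LinearMap.ext fun _ => rfl)
      comm₂₃ := ModuleCat.hom_ext (LinearMap.ext fun _ => rfl) }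
  have h := ShortComplex.ShortExact.extClass_naturality
    ((polyComplex_shortExact ξ).map_of_exact (restriction k f))
    (polyComplex_shortExact (charComap f ξ)) F
  have h₂ : (restriction k f).map (polyEval ξ) ≫ (restrictionTrivialIso k f).hom =
      τ ≫ polyEval (charComap f ξ) :=
    ModuleCat.hom_ext (LinearMap.ext fun _ => rfl)
  rw [charClass_eq, charClass_eq, cohomologyMap_apply, Ext.mapExactFunctor_comp,
    Ext.mapExactFunctor_mk₀, Ext.comp_assoc_of_third_deg_zero, Ext.mk₀_comp_mk₀, h₂,
    ← Ext.mk₀_comp_mk₀, ← Ext.comp_assoc_of_third_deg_zero, Ext.mapExactFunctor_extClass]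
  rw [← Ext.comp_assoc_of_third_deg_zero]
  refine congrArg (fun y => Ext.comp y (Ext.mk₀ (polyEval (charComap f ξ))) (add_zero 1)) ?_
  refine (Ext.comp_assoc_of_third_deg_zero _ _ _ _).trans ?_
  refine (congrArg (fun y => (Ext.mk₀ (restrictionTrivialIso k f).inv).comp y (zero_add 1))
    h).trans ?_
  refine (Ext.mk₀_comp_mk₀_assoc _ _ _).trans ?_
  refine (congrArg (fun y => (Ext.mk₀ y).comp (polyComplex_shortExact (charComap f ξ)).extClass
    (zero_add 1)) (Iso.inv_hom_id _)).trans (Ext.mk₀_id_comp _)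

variable (k g) in
/-- The product of `i` classes of degree one. -/
def classProd : (i : ℕ) → MultilinearMap k (fun _ : Fin i => Cohomology k g 1) (Cohomology k g i)
  | 0 => MultilinearMap.constOfIsEmpty k _ (Ext.mk₀ (𝟙 (trivialModule k g)))
  | i + 1 => LinearMap.uncurryLeft
      { toFun := fun x => (Ext.precompOfLinear x k (trivialModule k g)
          (add_comm 1 i)).compMultilinearMap (classProd i)
        map_add' := fun x y => by ext; simp
        map_smul' := fun a x => by ext; simp }

theorem classProd_succ {i : ℕ} (v : Fin (i + 1) → Cohomology k g 1) :
    classProd k g (i + 1) v = (v 0).comp (classProd k g i (Fin.tail v)) (add_comm 1 i) := rfl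

theorem cohomologyMap_classProd (f : g₁ →ₗ⁅k⁆ g₂) {i : ℕ} (v : Fin i → Cohomology k g₂ 1) :
    cohomologyMap k f i (classProd k g₂ i v) =
      classProd k g₁ i fun l => cohomologyMap k f 1 (v l) := by
  induction i with
  | zero => exact cohomologyMap_one f
  | succ i ih =>
    rw [classProd_succ, classProd_succ, cohomologyMap_mul, ih]
    rfl

theorem charClass_comp_charClass (ξ η : charSpace k g) :
    (charClass ξ).comp (charClass η) (show 1 + 1 = 2 from rfl) =
      -(charClass η).comp (charClass ξ) (show 1 + 1 = 2 from rfl) := by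
  -- Polarization of the square-zero relation.
  have h := charClass_comp_self (ξ + η)
  simp only [map_add, Ext.add_comp, Ext.comp_add, charClass_comp_self, zero_add, add_zero] at h
  exact eq_neg_of_add_eq_zero_left (by rwa [add_comm])

/-- The extra factor is moved to the right, with a sign at each exchange, until it meets its copy.
-/
theorem charClass_comp_classProd {i : ℕ} (v : Fin i → charSpace k g) (l : Fin i) :
    (charClass (v l)).comp (classProd k g i fun j => charClass (v j)) (add_comm 1 i) = 0 := by
  induction i with
  | zero => exact l.elim0
  | succ i ih =>
    rw [classProd_succ, ← Ext.comp_assoc (a₁₂ := 2) _ _ _ rfl (add_comm 1 i) (by lia)]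
    obtain rfl | ⟨l, rfl⟩ := l.eq_zero_or_eq_succ
    · rw [charClass_comp_self, Ext.zero_comp]
    · rw [charClass_comp_charClass, Ext.neg_comp,
        Ext.comp_assoc (a₂₃ := i + 1) _ _ _ rfl (add_comm 1 i) (by lia)]
      have := ih (fun j => v j.succ) l
      refine neg_eq_zero.2 ?_
      refine (congrArg (fun y => Ext.comp _ y _) this).trans (Ext.comp_zero _ _ _ _ _)

variable (k g) in
/-- The product of the classes of `i` characters. -/
def charProd (i : ℕ) : charSpace k g [⋀^Fin i]→ₗ[k] Cohomology k g i :=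
  { (classProd k g i).compLinearMap fun _ => charClass with
    map_eq_zero_of_eq' := by
      intro v a b hv hab
      change classProd k g i (fun j => charClass (v j)) = 0
      induction i with
      | zero => exact a.elim0
      | succ i ih =>
        rw [classProd_succ]
        obtain rfl | ⟨a, rfl⟩ := a.eq_zero_or_eq_succ
        · obtain rfl | ⟨b, rfl⟩ := b.eq_zero_or_eq_succ
          · exact absurd rfl hab
          · rw [hv]
            exact charClass_comp_classProd (fun j => v j.succ) b
        · obtain rfl | ⟨b, rfl⟩ := b.eq_zero_or_eq_succ
          · rw [← hv]
            exact charClass_comp_classProd (fun j => v j.succ) a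
          · exact (congrArg (fun y => Ext.comp _ y _) (ih (fun j => v j.succ) a b hv
              fun h => hab (congrArg Fin.succ h))).trans (Ext.comp_zero _ _ _ _ _) }

theorem charProd_apply {i : ℕ} (v : Fin i → charSpace k g) :
    charProd k g i v = classProd k g i fun j => charClass (v j) := rfl

theorem charProd_zero (v : Fin 0 → charSpace k g) :
    charProd k g 0 v = Ext.mk₀ (𝟙 (trivialModule k g)) := rfl

theorem charProd_succ {i : ℕ} (v : Fin (i + 1) → charSpace k g) :
    charProd k g (i + 1) v =
      (charClass (v 0)).comp (charProd k g i (Fin.tail v)) (add_comm 1 i) := rfl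

theorem cohomologyMap_charProd (f : g₁ →ₗ⁅k⁆ g₂) {i : ℕ} (v : Fin i → charSpace k g₂) :
    cohomologyMap k f i (charProd k g₂ i v) = charProd k g₁ i fun l => charComap f (v l) := by
  simp only [charProd_apply, cohomologyMap_classProd, cohomologyMap_charClass]

end CharClass

/-! ### One step of the Koszul resolution -/

section Koszul

attribute [local instance] LieRing.ofAssociativeRing

open Polynomial

variable {m n : ℕ}

/-- The coordinates of the abelianization `L → V`. -/
def abelCoord (b : Fin m) : L m →ₗ⁅ℂ⁆ ℂ :=
  FreeLieAlgebra.lift ℂ fun b' => (Pi.single b' 1 : V m) b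

variable (m) in
/-- The abelianization `L → V`. -/
def abel : L m →ₗ[ℂ] V m := LinearMap.pi fun b => (abelCoord b : L m →ₗ[ℂ] ℂ)

theorem abel_of (b : Fin m) : abel m (FreeLieAlgebra.of ℂ b) = Pi.single b 1 :=
  funext fun _ => FreeLieAlgebra.lift_of_apply _ _

theorem abel_lie (x y : L m) : abel m ⁅x, y⁆ = 0 :=
  funext fun b => ((abelCoord b).map_lie x y).trans (by
    rw [LieRing.of_associative_ring_bracket, mul_comm, sub_self]; rfl)

theorem abel_freeMap (a : V m →ₗ[ℂ] V m) (x : L m) : abel m (freeMap a x) = a (abel m x) := by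
  refine funext fun b => ?_
  let f : L m →ₗ⁅ℂ⁆ ℂ :=
    { toLinearMap := LinearMap.proj b ∘ₗ a ∘ₗ abel m
      map_lie' := fun {x y} => by
        rw [LieRing.of_associative_ring_bracket, mul_comm, sub_self]
        simp [abel_lie] }
  have h : (abelCoord b).comp (freeMap a) = f := FreeLieAlgebra.hom_ext fun b' => by
    change abel m (freeMap a (FreeLieAlgebra.of ℂ b')) b = a (abel m (FreeLieAlgebra.of ℂ b')) b
    rw [← inclusion_single, freeMap_inclusion, inclusion_single, abel_of]
    generalize a (Pi.single b' 1) = v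
    simp [inclusion, Fintype.linearCombination_apply, abel_of, Finset.sum_apply, Pi.single_apply]
  exact LieHom.congr_fun h x

variable (m n) in
/-- The character of `𝔤` given by a linear form on `V` for each summand. -/
def genChar : (Fin n → Module.Dual ℂ (V m)) →ₗ[ℂ] charSpace ℂ (𝔤 m n) :=
  LinearMap.codRestrict _
    (∑ j, (abel m ∘ₗ DirectSum.component ℂ (Fin n) (fun _ => L m) j).dualMap ∘ₗ LinearMap.proj j)
    fun ξ x y => by
      rw [LinearMap.sum_apply, LinearMap.sum_apply]
      refine Finset.sum_eq_zero fun j _ => ?_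
      change ξ j (abel m (⁅x, y⁆ j)) = 0
      rw [DirectSum.bracket_apply, abel_lie, map_zero]

theorem genChar_apply (ξ : Fin n → Module.Dual ℂ (V m)) (x : 𝔤 m n) :
    (genChar m n ξ : Module.Dual ℂ (𝔤 m n)) x = ∑ j, ξ j (abel m (x j)) := by
  refine (LinearMap.congr_fun (LinearMap.sum_apply _ _ ξ) x).trans ?_
  rw [LinearMap.sum_apply]
  rfl

theorem genChar_of (ξ : Fin n → Module.Dual ℂ (V m)) (j : Fin n) (b : Fin m) :
    (genChar m n ξ : Module.Dual ℂ (𝔤 m n))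
      (DirectSum.of (fun _ : Fin n => L m) j (FreeLieAlgebra.of ℂ b)) = ξ j (Pi.single b 1) := by
  rw [genChar_apply, Finset.sum_eq_single j]
  · rw [DirectSum.of_eq_same, abel_of]
  · intro j' _ h
    rw [DirectSum.of_eq_of_ne _ _ _ h, map_zero, map_zero]
  · simp

theorem charComap_permAct (σ : Equiv.Perm (Fin n)) (ξ : Fin n → Module.Dual ℂ (V m)) :
    charComap (permAct m n σ) (genChar m n ξ) = genChar m n fun j => ξ (σ j) := by
  refine Subtype.ext (LinearMap.ext fun x => ?_)
  rw [charComap_apply, genChar_apply, genChar_apply]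
  simp only [permAct_apply]
  rw [← Equiv.sum_comp σ]
  simp

theorem charComap_glAct (a : GLV m) (ξ : Fin n → Module.Dual ℂ (V m)) :
    charComap (glAct m n a) (genChar m n ξ) =
      genChar m n fun j => ξ j ∘ₗ (a : V m →ₗ[ℂ] V m) := by
  refine Subtype.ext (LinearMap.ext fun x => ?_)
  rw [charComap_apply, genChar_apply, genChar_apply]
  simp only [glAct_apply, abel_freeMap]
  rfl

/-- The character of `𝔤` given by a linear form on `V` for the `j`-th summand. -/
def singleChar (j : Fin n) (ξ : Module.Dual ℂ (V m)) : charSpace ℂ (𝔤 m n) :=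
  genChar m n (Pi.single j ξ)

theorem polyMap_singleChar_gen (j j' : Fin n) (ξ : Module.Dual ℂ (V m)) (b : Fin m) :
    polyMap (singleChar j ξ) (gen j' b) =
      if j' = j then ξ (Pi.single b 1) • (X : ℂ[X]) else 0 := by
  rw [gen, polyMap_ι, singleChar, genChar_of]
  split_ifs with h
  · subst h; simp
  · simp [h]

/-- The quotient of the enveloping algebra by the left ideal generated by the summands of index
at least `t`. -/
abbrev tailModule (m : ℕ) {n : ℕ} (t : Fin (n + 1)) : ModuleCat.{0} (Env m n) :=
  ModuleCat.of _ (Env m n ⧸ tailIdeal (m := m) t)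

/-- The map from `tailModule` to the trivial module induced by the augmentation. -/
def tailAug (m : ℕ) {n : ℕ} (t : Fin (n + 1)) : tailModule m t ⟶ trivialModule ℂ (𝔤 m n) :=
  ModuleCat.ofHom (Y := trivialModule ℂ (𝔤 m n)) (Submodule.liftQ
    (M₂ := trivialModule ℂ (𝔤 m n)) _ (augHom ℂ (𝔤 m n)).hom fun _ hr =>
    tailIdeal_le_ker (augmentation ℂ (𝔤 m n)) (fun j b _ => augmentation_gen j b) hr)

/-- Right multiplication by a generator of the `j`-th summand. -/
def mulGen (j : Fin n) (b : Fin m) :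
    (Env m n ⧸ tailIdeal (m := m) j.succ) →ₗ[Env m n] Env m n ⧸ tailIdeal (m := m) j.succ :=
  Submodule.mapQ _ _ (LinearMap.toSpanSingleton _ _ (gen j b)) fun _ hr =>
    mul_gen_mem_tailIdeal b hr

theorem mulGen_mk (j : Fin n) (b : Fin m) (r : Env m n) :
    mulGen j b (Submodule.Quotient.mk r) = Submodule.Quotient.mk (r * gen j b) := rfl

/-- The direct sum of right multiplications by the generators of the `j`-th summand. -/
def sumMulGen (j : Fin n) :
    (Fin m → Env m n ⧸ tailIdeal (m := m) j.succ) →ₗ[Env m n]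
      Env m n ⧸ tailIdeal (m := m) j.succ :=
  ∑ b, mulGen j b ∘ₗ LinearMap.proj b

theorem sumMulGen_mk (j : Fin n) (s : Fin m → Env m n) :
    sumMulGen j (fun b => (Submodule.Quotient.mk (s b) : Env m n ⧸ tailIdeal (m := m) j.succ)) =
      Submodule.Quotient.mk (∑ b, s b * gen j b) := by
  rw [sumMulGen, LinearMap.sum_apply]
  simp only [LinearMap.comp_apply, LinearMap.proj_apply, mulGen_mk]
  exact (map_sum (Submodule.mkQ (tailIdeal (m := m) j.succ)) _ _).symm

theorem exists_rep (j : Fin n) (v : Fin m → Env m n ⧸ tailIdeal (m := m) j.succ) :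
    ∃ s : Fin m → Env m n, v = fun b => Submodule.Quotient.mk (s b) := by
  choose s hs using fun b => Submodule.Quotient.mk_surjective _ (v b)
  exact ⟨s, funext fun b => (hs b).symm⟩

theorem stepIdeal_le (j : Fin n) : tailIdeal (m := m) j.succ ≤ tailIdeal j.castSucc :=
  tailIdeal_antitone Fin.castSucc_lt_succ.le

/-- One step of the Koszul resolution: modulo the summands of index greater than `j`, the left ideal
generated by the `j`-th summand is free. -/
abbrev stepComplex (m : ℕ) {n : ℕ} (j : Fin n) : ShortComplex (ModuleCat.{0} (Env m n)) :=
  ShortComplex.mk (X₁ := ModuleCat.of _ (Fin m → Env m n ⧸ tailIdeal (m := m) j.succ))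
    (X₂ := tailModule m j.succ) (X₃ := tailModule m j.castSucc)
    (ModuleCat.ofHom (sumMulGen j))
    (ModuleCat.ofHom (Submodule.factor (stepIdeal_le j)))
    (by
      refine ModuleCat.hom_ext (LinearMap.ext fun v => ?_)
      obtain ⟨s, rfl⟩ := exists_rep j v
      refine (congrArg (Submodule.factor (stepIdeal_le j)) (sumMulGen_mk j s)).trans ?_
      have h : ∑ b, s b * gen j b ∈ tailIdeal (m := m) j.castSucc :=
        Submodule.sum_mem _ fun b _ => Submodule.smul_mem _ _ (gen_mem_tailIdeal le_rfl b)
      exact (Submodule.Quotient.mk_eq_zero _).2 h)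

/-- Exactness in the middle says that the generators of summand `j`, added to the later ones,
generate the next tail ideal; injectivity is `mem_tailIdeal_of_sum_mem`. -/
theorem stepComplex_shortExact (j : Fin n) : (stepComplex m j).ShortExact where
  exact := by
    rw [ShortComplex.moduleCat_exact_iff]
    intro x hx
    obtain ⟨r, rfl⟩ := Submodule.Quotient.mk_surjective _ x
    obtain ⟨s, hs⟩ := exists_sub_mem_tailIdeal_succ ((Submodule.Quotient.mk_eq_zero _).1 hx)
    refine ⟨fun b => Submodule.Quotient.mk (s b), (sumMulGen_mk j s).trans ?_⟩
    exact ((Submodule.Quotient.eq _).2 hs).symm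
  mono_f := by
    refine (ModuleCat.mono_iff_injective _).2 ?_
    refine (injective_iff_map_eq_zero (sumMulGen j)).2 fun v hv => ?_
    obtain ⟨s, rfl⟩ := exists_rep j v
    rw [sumMulGen_mk, Submodule.Quotient.mk_eq_zero] at hv
    exact funext fun b => (Submodule.Quotient.mk_eq_zero _).2 (mem_tailIdeal_of_sum_mem hv b)
  epi_g := (ModuleCat.epi_iff_surjective _).2 (Submodule.factor_surjective (stepIdeal_le j))

/-- The projection of the first term of `stepComplex` to a factor. -/
def stepProj (j : Fin n) (b : Fin m) : (stepComplex m j).X₁ ⟶ tailModule m j.succ :=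
  ModuleCat.ofHom (LinearMap.proj b)

/-- The inclusion of a factor in the first term of `stepComplex`. -/
def stepIncl (j : Fin n) (b : Fin m) : tailModule m j.succ ⟶ (stepComplex m j).X₁ :=
  ModuleCat.ofHom (LinearMap.single _ (fun _ => Env m n ⧸ tailIdeal (m := m) j.succ) b)

theorem stepIncl_stepProj (j : Fin n) (b b' : Fin m) :
    stepIncl j b ≫ stepProj j b' = if b = b' then 𝟙 (tailModule m j.succ) else 0 := by
  refine ModuleCat.hom_ext (LinearMap.ext fun x => ?_)
  change (Pi.single b x : Fin m → Env m n ⧸ tailIdeal (m := m) j.succ) b' = _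
  split_ifs with h
  · subst h
    rw [Pi.single_eq_same]
    rfl
  · rw [Pi.single_eq_of_ne' h]
    rfl

theorem sum_stepProj_stepIncl (j : Fin n) :
    ∑ b, stepProj j b ≫ stepIncl j b = 𝟙 (stepComplex m j).X₁ := by
  refine ModuleCat.hom_ext (LinearMap.ext fun v => ?_)
  rw [ModuleCat.hom_sum, LinearMap.sum_apply]
  exact Finset.univ_sum_single v

theorem step_g_tailAug (j : Fin n) :
    (stepComplex m j).g ≫ tailAug m j.castSucc = tailAug m j.succ := by
  refine ModuleCat.hom_ext (LinearMap.ext fun x => ?_)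
  obtain ⟨r, rfl⟩ := Submodule.Quotient.mk_surjective _ x
  rfl

theorem step_f_tailAug (j : Fin n) : (stepComplex m j).f ≫ tailAug m j.succ = 0 := by
  rw [← step_g_tailAug, ← Category.assoc, (stepComplex m j).zero, Limits.zero_comp]

/-- The `b`-th component of the step extension maps to the `k[X]` extension of the `b`-th coordinate
character of summand `j`: `polyMap` kills the later summands and sends `gen j b` to `X`. Naturality
of extension classes then compares the two. -/
theorem step_extClass_comp (j : Fin n) (b : Fin m) :
    (stepComplex_shortExact (m := m) j).extClass.comp
      (Ext.mk₀ (stepProj j b ≫ tailAug m j.succ)) (add_zero 1) =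
    (Ext.mk₀ (tailAug m j.castSucc)).comp (charClass (singleChar j (LinearMap.proj b)))
      (zero_add 1) := by
  set ξ := singleChar (n := n) j (LinearMap.proj b : V m →ₗ[ℂ] ℂ) with hξ
  let p : Env m n →ₗ[Env m n] polyModule ξ :=
    { toFun := fun r => (polyMap ξ r : ℂ[X])
      map_add' := fun r s => map_add (polyMap ξ) r s
      map_smul' := fun r s => map_mul (polyMap ξ) r s }
  let τ : tailModule m j.succ ⟶ polyModule ξ := ModuleCat.ofHom (Y := polyModule ξ)
      (Submodule.liftQ (M₂ := polyModule ξ) _ p fun r hr => by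
    refine tailIdeal_le_ker (polyMap ξ) (fun j' b' h => ?_) hr
    have hne : j' ≠ j := by
      rintro rfl
      exact absurd h (not_le.2 (Fin.castSucc_lt_succ))
    rw [hξ, polyMap_singleChar_gen, if_neg hne])
  let F : stepComplex m j ⟶ polyComplex ξ :=
    { τ₁ := stepProj j b ≫ τ
      τ₂ := τ
      τ₃ := tailAug m j.castSucc
      comm₁₂ := by
        refine ModuleCat.hom_ext (LinearMap.ext fun v => ?_)
        obtain ⟨s, rfl⟩ := exists_rep j v
        refine Eq.trans ?_ (congrArg τ.hom (sumMulGen_mk j s)).symm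
        change polyMap ξ (s b) * X = polyMap ξ (∑ b, s b * gen j b)
        simp [hξ, polyMap_singleChar_gen, Pi.single_apply]
      comm₂₃ := by
        refine ModuleCat.hom_ext (LinearMap.ext fun x => ?_)
        obtain ⟨r, rfl⟩ := Submodule.Quotient.mk_surjective _ x
        exact (coeff_zero_polyMap ξ r) }
  have h := ShortComplex.ShortExact.extClass_naturality (stepComplex_shortExact (m := m) j)
    (polyComplex_shortExact ξ) F
  have hτ : stepProj j b ≫ tailAug m j.succ = (stepProj j b ≫ τ) ≫ polyEval ξ := by
    rw [Category.assoc]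
    congr 1
    refine ModuleCat.hom_ext (LinearMap.ext fun x => ?_)
    obtain ⟨r, rfl⟩ := Submodule.Quotient.mk_surjective _ x
    exact (coeff_zero_polyMap ξ r).symm
  rw [hτ, ← Ext.mk₀_comp_mk₀, ← Ext.comp_assoc_of_third_deg_zero, charClass_eq]
  refine (congrArg (fun y => Ext.comp y (Ext.mk₀ (polyEval ξ)) (add_zero 1)) h).trans ?_
  exact Ext.comp_assoc_of_third_deg_zero _ _ _ _

end Koszul

/-! ### Computation of the cohomology by descending induction -/

section Induction

variable {m n : ℕ}

theorem finite_and_finrank_of_exact {K A B C : Type*} [Field K] [AddCommGroup A] [Module K A]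
    [AddCommGroup B] [Module K B] [AddCommGroup C] [Module K C] [Module.Finite K A]
    [Module.Finite K C] {f : A →ₗ[K] B} {g : B →ₗ[K] C} (hf : Function.Injective f)
    (hg : Function.Surjective g) (h : Function.Exact f g) :
    Module.Finite K B ∧ Module.finrank K B = Module.finrank K A + Module.finrank K C := by
  have hker : LinearMap.ker g = LinearMap.range f := h.linearMap_ker_eq
  have e₁ := LinearEquiv.ofInjective f hf
  have e₂ := g.quotKerEquivOfSurjective hg
  have : Module.Finite K (LinearMap.ker g) := by
    rw [hker]; exact Module.Finite.equiv e₁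
  have : Module.Finite K (B ⧸ LinearMap.ker g) := Module.Finite.equiv e₂.symm
  have hB : Module.Finite K B := Module.Finite.of_submodule_quotient (LinearMap.ker g)
  refine ⟨hB, ?_⟩
  rw [← (LinearMap.ker g).finrank_quotient_add_finrank, e₂.finrank_eq, add_comm]
  congr 1
  rw [hker, ← e₁.finrank_eq]

/-- The cohomology groups of `tailModule`. -/
abbrev TailExt (m : ℕ) {n : ℕ} (t : Fin (n + 1)) (i : ℕ) : Type :=
  Ext (tailModule m t) (trivialModule ℂ (𝔤 m n)) i

/-- Pullback of cohomology classes along `tailAug`. -/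
def tailPull (m : ℕ) {n : ℕ} (t : Fin (n + 1)) (i : ℕ) :
    Cohomology ℂ (𝔤 m n) i →ₗ[ℂ] TailExt m t i :=
  Ext.precompOfLinear (Ext.mk₀ (tailAug m t)) ℂ _ (zero_add i)

theorem tailPull_apply (t : Fin (n + 1)) (i : ℕ) (z : Cohomology ℂ (𝔤 m n) i) :
    tailPull m t i z = (Ext.mk₀ (tailAug m t)).comp z (zero_add i) := rfl

/-- The span of the products of classes of characters of distinct summands of index at
least `t`. -/
def prodSpan (m : ℕ) {n : ℕ} (t : Fin (n + 1)) (i : ℕ) :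
    Submodule ℂ (Cohomology ℂ (𝔤 m n) i) :=
  Submodule.span ℂ {z | ∃ (h : Fin i → Fin n) (ξ : Fin i → Module.Dual ℂ (V m)), StrictMono h ∧
    (∀ l, t ≤ (h l).castSucc) ∧
      z = charProd ℂ (𝔤 m n) i fun l => singleChar (h l) (ξ l)}

theorem prodSpan_antitone {s t : Fin (n + 1)} (h : s ≤ t) (i : ℕ) :
    prodSpan m t i ≤ prodSpan m s i :=
  Submodule.span_mono fun _ ⟨f, ξ, hf, hft, e⟩ => ⟨f, ξ, hf, fun l => h.trans (hft l), e⟩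

theorem charClass_comp_mem_prodSpan (j : Fin n) (ξ : Module.Dual ℂ (V m)) {i : ℕ}
    {z : Cohomology ℂ (𝔤 m n) i} (hz : z ∈ prodSpan m j.succ i) :
    (charClass (singleChar j ξ)).comp z (add_comm 1 i) ∈ prodSpan m j.castSucc (i + 1) := by
  suffices prodSpan m j.succ i ≤ (prodSpan m j.castSucc (i + 1)).comap
      (Ext.precompOfLinear (charClass (singleChar j ξ)) ℂ _ (add_comm 1 i)) from this hz
  refine Submodule.span_le.2 ?_
  rintro _ ⟨h, η, hh, hj, rfl⟩
  -- All summands occurring in the product come after `j`, so prepending `j` keeps the indices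
  -- strictly increasing.
  refine Submodule.subset_span ⟨Fin.cons j h, Fin.cons ξ η, Fin.strictMono_cons.2
    ⟨fun l => Fin.succ_le_castSucc_iff.1 (hj l), hh⟩, fun l => ?_, ?_⟩
  · refine Fin.cases le_rfl (fun l => ?_) l
    exact (Fin.castSucc_lt_succ.le).trans (hj l)
  · rw [charProd_succ]
    rfl

theorem tailAug_ne_zero (t : Fin (n + 1)) : tailAug m t ≠ 0 := by
  intro h
  have h' : (tailAug m t).hom (Submodule.Quotient.mk 1) = 0 := by rw [h]; rfl
  have h_one : augmentation ℂ (𝔤 m n) 1 = 0 := h'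
  rw [map_one] at h_one
  exact one_ne_zero h_one

/-- The module is cyclic, so a map out of it is determined by the image of the class of 1. -/
theorem exists_smul_tailAug (t : Fin (n + 1)) (f : tailModule m t ⟶ trivialModule ℂ (𝔤 m n)) :
    ∃ c : ℂ, c • tailAug m t = f := by
  refine ⟨f.hom (Submodule.Quotient.mk 1), ModuleCat.hom_ext ?_⟩
  refine Submodule.linearMap_qext _ (LinearMap.ext_ring ?_)
  have h : ∀ c : ℂ, augmentation ℂ (𝔤 m n) (algebraMap ℂ _ c) * augmentation ℂ (𝔤 m n) 1 = c := by
    intro c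
    rw [AlgHom.commutes, map_one, mul_one]
    rfl
  exact h (f.hom (Submodule.Quotient.mk 1))

/-- The induction hypothesis in the computation of the cohomology. -/
structure TailExtSpec (m : ℕ) {n : ℕ} (t : Fin (n + 1)) (i : ℕ) : Prop where
  finite : Module.Finite ℂ (TailExt m t i)
  finrank_eq : Module.finrank ℂ (TailExt m t i) = (n - t).choose i * m ^ i
  map_eq : (prodSpan m t i).map (tailPull m t i) = ⊤

theorem tailExtSpec_zero (t : Fin (n + 1)) : TailExtSpec m t 0 := by
  have h0 : Ext.mk₀ (tailAug m t) ≠ 0 := fun h => tailAug_ne_zero t ((Ext.mk₀_eq_zero_iff _).1 h)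
  have h1 : ∀ w : TailExt m t 0, ∃ c : ℂ, c • Ext.mk₀ (tailAug m t) = w := by
    intro w
    obtain ⟨f, rfl⟩ := (Ext.mk₀_bijective _ _).2 w
    obtain ⟨c, rfl⟩ := exists_smul_tailAug t f
    exact ⟨c, (Ext.mk₀_smul c _).symm⟩
  have h2 : Module.finrank ℂ (TailExt m t 0) = 1 := (finrank_eq_one_iff_of_nonzero' _ h0).2 h1
  refine ⟨Module.finite_of_finrank_eq_succ h2, by simpa using h2, eq_top_iff.2 fun w _ => ?_⟩
  obtain ⟨c, rfl⟩ := h1 w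
  refine Submodule.smul_mem _ _ ⟨charProd ℂ (𝔤 m n) 0 fun l => l.elim0, Submodule.subset_span
    ⟨fun l => l.elim0, fun l => l.elim0, fun l => l.elim0, fun l => l.elim0, ?_⟩, ?_⟩
  · congr 1
    exact funext fun l => l.elim0
  · rw [charProd_zero, tailPull_apply, Ext.comp_mk₀_id]

/-- The last tail ideal is zero, so the module is free and its higher Ext groups vanish. -/
theorem tailExtSpec_last (i : ℕ) : TailExtSpec m (Fin.last n) (i + 1) := by
  have : Projective (tailModule m (Fin.last n)) := by
    have e := (Submodule.quotEquivOfEqBot _ (tailIdeal_last (m := m) (n := n)))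
    have : Module.Projective (Env m n) (Env m n ⧸ tailIdeal (m := m) (Fin.last n)) :=
      Module.Projective.of_equiv e.symm
    exact (IsProjective.iff_projective _).1 this
  have : Subsingleton (TailExt m (Fin.last n) (i + 1)) :=
    Ext.subsingleton_of_projective _ _ _
  refine ⟨inferInstance, ?_, Subsingleton.elim _ _⟩
  rw [Module.finrank_zero_of_subsingleton]
  simp

/-- By the spanning hypothesis every class is pulled back along the augmentation, which is zero on
the image of the step map. This breaks the long exact sequence into short ones. -/
theorem step_f_comp_eq_zero {j : Fin n} {i : ℕ} (H : TailExtSpec m j.succ i)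
    (x : TailExt m j.succ i) : (Ext.mk₀ (stepComplex m j).f).comp x (zero_add i) = 0 := by
  obtain ⟨z, -, rfl⟩ := (H.map_eq ▸ Submodule.mem_top : x ∈ (prodSpan m j.succ i).map _)
  rw [tailPull_apply, Ext.mk₀_comp_mk₀_assoc, step_f_tailAug, Ext.mk₀_zero, Ext.zero_comp]

/-- The cohomology of the first term of `stepComplex`. -/
def stepEquiv (j : Fin n) (i : ℕ) :
    (Fin m → TailExt m j.succ i) ≃ₗ[ℂ]
      Ext (stepComplex m j).X₁ (trivialModule ℂ (𝔤 m n)) i :=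
  LinearEquiv.ofLinearMap
    (LinearMap.lsum ℂ _ ℂ fun b =>
      Ext.precompOfLinear (Ext.mk₀ (stepProj j b)) ℂ _ (zero_add i))
    (LinearMap.pi fun b => Ext.precompOfLinear (Ext.mk₀ (stepIncl j b)) ℂ _ (zero_add i))
    (by
      ext y
      simp only [LinearMap.comp_apply, LinearMap.lsum_apply, LinearMap.sum_apply,
        LinearMap.pi_apply, LinearMap.proj_apply, Ext.bilinearCompOfLinear_apply_apply,
        Ext.mk₀_comp_mk₀_assoc, ← Ext.sum_comp, ← Ext.mk₀_sum]
      rw [sum_stepProj_stepIncl, Ext.mk₀_id_comp]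
      rfl)
    (by
      ext b y b'
      simp only [LinearMap.comp_apply, LinearMap.lsum_apply, LinearMap.sum_apply,
        LinearMap.pi_apply, LinearMap.proj_apply, Ext.bilinearCompOfLinear_apply_apply,
        Ext.comp_sum, Ext.mk₀_comp_mk₀_assoc, stepIncl_stepProj, LinearMap.id_apply]
      rw [Finset.sum_eq_single b']
      · rw [if_pos rfl, Ext.mk₀_id_comp]
      · intro x _ hx
        rw [if_neg hx.symm, Ext.mk₀_zero, Ext.zero_comp]
      · simp)

theorem stepEquiv_apply (j : Fin n) (i : ℕ) (v : Fin m → TailExt m j.succ i) :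
    stepEquiv j i v = ∑ b, (Ext.mk₀ (stepProj j b)).comp (v b) (zero_add i) := by
  simp [stepEquiv]

/-- The connecting map of `stepComplex`. -/
def stepDelta (j : Fin n) (i : ℕ) :
    (Fin m → TailExt m j.succ i) →ₗ[ℂ] TailExt m j.castSucc (i + 1) :=
  Ext.precompOfLinear (stepComplex_shortExact (m := m) j).extClass ℂ _ (add_comm 1 i) ∘ₗ
    (stepEquiv j i).toLinearMap

/-- On pulled-back classes the connecting map is multiplication by the coordinate classes of summand
`j`, so it sends products to products. -/
theorem stepDelta_tailPull (j : Fin n) (i : ℕ) (z : Fin m → Cohomology ℂ (𝔤 m n) i) :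
    stepDelta j i (fun b => tailPull m j.succ i (z b)) = tailPull m j.castSucc (i + 1)
      (∑ b, (charClass (singleChar j (LinearMap.proj b))).comp (z b) (add_comm 1 i)) := by
  rw [map_sum]
  change (stepComplex_shortExact (m := m) j).extClass.comp (stepEquiv j i _) (add_comm 1 i) = _
  rw [stepEquiv_apply, Ext.comp_sum]
  refine Finset.sum_congr rfl fun b _ => ?_
  rw [tailPull_apply, tailPull_apply, Ext.mk₀_comp_mk₀_assoc,
    ← Ext.comp_assoc (a₁₂ := 1) _ _ _ (zero_add 1) (add_comm 1 i) (by lia), ← step_extClass_comp,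
    Ext.comp_assoc (a₂₃ := i) _ _ _ (add_zero 1) (zero_add i) (by lia)]

/-- Pullback along the quotient map of `stepComplex`. -/
def stepRestrict (j : Fin n) (i : ℕ) : TailExt m j.castSucc i →ₗ[ℂ] TailExt m j.succ i :=
  Ext.precompOfLinear (Ext.mk₀ (stepComplex m j).g) ℂ _ (zero_add i)

theorem stepRestrict_tailPull (j : Fin n) (i : ℕ) (z : Cohomology ℂ (𝔤 m n) i) :
    stepRestrict j i (tailPull m j.castSucc i z) = tailPull m j.succ i z := by
  change (Ext.mk₀ (stepComplex m j).g).comp ((Ext.mk₀ (tailAug m j.castSucc)).comp z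
    (zero_add i)) (zero_add i) = _
  rw [Ext.mk₀_comp_mk₀_assoc, step_g_tailAug]
  rfl

theorem tailExtSpec_succ (j : Fin n) (i : ℕ) (H₀ : TailExtSpec m j.succ i)
    (H : TailExtSpec m j.succ (i + 1)) : TailExtSpec m j.castSucc (i + 1) := by
  have := H₀.finite
  have := H.finite
  have hinj : Function.Injective (stepDelta (m := m) j i) := by
    refine (injective_iff_map_eq_zero _).2 fun v hv => ?_
    obtain ⟨x, hx⟩ := Ext.contravariant_sequence_exact₁ (stepComplex_shortExact (m := m) j) _
      (stepEquiv j i v) (add_comm 1 i) hv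
    rw [step_f_comp_eq_zero H₀] at hx
    exact (stepEquiv j i).map_eq_zero_iff.1 hx.symm
  have hsurj : Function.Surjective (stepRestrict (m := m) j (i + 1)) := fun x =>
    Ext.contravariant_sequence_exact₂ (stepComplex_shortExact (m := m) j) _ x
      (step_f_comp_eq_zero H x)
  have hex : Function.Exact (stepDelta (m := m) j i) (stepRestrict j (i + 1)) := by
    intro y
    constructor
    · intro hy
      obtain ⟨x, hx⟩ := Ext.contravariant_sequence_exact₃ (stepComplex_shortExact (m := m) j) _ y
        hy (add_comm 1 i)
      refine ⟨(stepEquiv j i).symm x, ?_⟩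
      change (stepComplex_shortExact (m := m) j).extClass.comp
        (stepEquiv j i ((stepEquiv j i).symm x)) (add_comm 1 i) = y
      rw [LinearEquiv.apply_symm_apply, hx]
    · rintro ⟨v, rfl⟩
      exact (stepComplex_shortExact (m := m) j).comp_extClass_assoc _ (add_comm 1 i)
  obtain ⟨hfin, hrank⟩ := finite_and_finrank_of_exact hinj hsurj hex
  refine ⟨hfin, ?_, eq_top_iff.2 fun y _ => ?_⟩
  · rw [hrank, Module.finrank_pi_fintype, H.finrank_eq, H₀.finrank_eq]
    -- Exposes the successor needed for Pascal's rule.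
    have hj : n - (j.castSucc : ℕ) = (n - (j.succ : ℕ)) + 1 := by
      have := j.2
      simp only [Fin.val_castSucc, Fin.val_succ]
      lia
    rw [hj, Nat.choose_succ_succ]
    simp
    ring
  · obtain ⟨z, hz, hzy⟩ :=
      (H.map_eq ▸ Submodule.mem_top : stepRestrict j (i + 1) y ∈ (prodSpan m j.succ (i + 1)).map _)
    -- A product class `z` lifts the restriction of `y`; the difference comes from the connecting
    -- map, hence from products with one factor on summand `j`.
    obtain ⟨v, hv⟩ := (hex (y - tailPull m j.castSucc (i + 1) z)).1 (by
      rw [map_sub, stepRestrict_tailPull, hzy, sub_self])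
    choose w hw hwv using fun b =>
      (H₀.map_eq ▸ Submodule.mem_top : v b ∈ (prodSpan m j.succ i).map _)
    obtain rfl : (fun b => tailPull m j.succ i (w b)) = v := funext hwv
    rw [stepDelta_tailPull, eq_sub_iff_add_eq, ← map_add] at hv
    refine ⟨_, add_mem (Submodule.sum_mem _ fun b _ => ?_) ?_, hv⟩
    · exact charClass_comp_mem_prodSpan j _ (hw b)
    · exact prodSpan_antitone Fin.castSucc_lt_succ.le _ hz

theorem tailExtSpec (t : Fin (n + 1)) (i : ℕ) : TailExtSpec m t i := by
  induction t using Fin.reverseInduction generalizing i with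
  | last =>
    cases i with
    | zero => exact tailExtSpec_zero _
    | succ i => exact tailExtSpec_last i
  | cast j ih =>
    cases i with
    | zero => exact tailExtSpec_zero _
    | succ i => exact tailExtSpec_succ j i (ih i) (ih (i + 1))

/-- The ideal at index 0 is the augmentation ideal, so `tailAug` is an isomorphism there. -/
theorem tailPull_zero_bijective (i : ℕ) :
    Function.Bijective (tailPull m (0 : Fin (n + 1)) i) := by
  have : IsIso (tailAug m (0 : Fin (n + 1))) := by
    rw [ConcreteCategory.isIso_iff_bijective]
    constructor
    · refine (injective_iff_map_eq_zero (tailAug m (0 : Fin (n + 1))).hom).2 fun x hx => ?_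
      obtain ⟨r, rfl⟩ := Submodule.Quotient.mk_surjective _ x
      exact (Submodule.Quotient.mk_eq_zero _).2 (mem_tailIdeal_zero_iff.2 hx)
    · intro a
      exact ⟨Submodule.Quotient.mk (algebraMap ℂ (Env m n) a), (augmentation ℂ (𝔤 m n)).commutes a⟩
  refine Function.bijective_iff_has_inverse.2
    ⟨fun x => (Ext.mk₀ (inv (tailAug m (0 : Fin (n + 1))))).comp x (zero_add i), fun z => ?_,
      fun x => ?_⟩
  · beta_reduce
    rw [tailPull_apply, Ext.mk₀_comp_mk₀_assoc, IsIso.inv_hom_id, Ext.mk₀_id_comp]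
  · rw [tailPull_apply, Ext.mk₀_comp_mk₀_assoc, IsIso.hom_inv_id, Ext.mk₀_id_comp]

/-- The isomorphism of the cohomology with that of `tailModule m 0`. -/
def tailEquiv (m n i : ℕ) : Cohomology ℂ (𝔤 m n) i ≃ₗ[ℂ] TailExt m (0 : Fin (n + 1)) i :=
  LinearEquiv.ofBijective _ (tailPull_zero_bijective i)

theorem cohomology_finite (m n i : ℕ) : Module.Finite ℂ (Cohomology ℂ (𝔤 m n) i) :=
  have := (tailExtSpec (m := m) (0 : Fin (n + 1)) i).finite
  Module.Finite.equiv (tailEquiv m n i).symm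

theorem cohomology_finrank (m n i : ℕ) :
    Module.finrank ℂ (Cohomology ℂ (𝔤 m n) i) = n.choose i * m ^ i := by
  rw [(tailEquiv m n i).finrank_eq, (tailExtSpec (m := m) (0 : Fin (n + 1)) i).finrank_eq]
  simp

theorem cohomology_subsingleton (m : ℕ) {n i : ℕ} (h : n < i) :
    Subsingleton (Cohomology ℂ (𝔤 m n) i) := by
  have := cohomology_finite m n i
  refine (Module.finrank_zero_iff (R := ℂ)).1 ?_
  rw [cohomology_finrank, Nat.choose_eq_zero_of_lt h, zero_mul]

theorem prodSpan_zero_eq_top (m n i : ℕ) : prodSpan m (0 : Fin (n + 1)) i = ⊤ := by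
  refine eq_top_iff.2 fun z _ => ?_
  obtain ⟨w, hw, h⟩ := ((tailExtSpec (m := m) (0 : Fin (n + 1)) i).map_eq ▸ Submodule.mem_top :
    tailPull m 0 i z ∈ (prodSpan m (0 : Fin (n + 1)) i).map _)
  rwa [← (tailPull_zero_bijective i).1 h]

end Induction

/-! ### Frobenius reciprocity for induced representations -/

section IndLift

open Representation

variable {k G H A B : Type*} [CommRing k] [Group G] [Group H] [AddCommGroup A] [Module k A]
  [AddCommGroup B] [Module k B]

/-- Frobenius reciprocity: the map from an induced representation given by an equivariant map. -/
def indLift (φ : G →* H) (ρ : Representation k G A) (τ : Representation k H B) (f : A →ₗ[k] B)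
    (hf : ∀ g, f ∘ₗ ρ g = τ (φ g) ∘ₗ f) : IndV φ ρ →ₗ[k] B :=
  Coinvariants.lift _
    (TensorProduct.lift <| (Finsupp.lift _ _ _ fun h => τ h⁻¹ ∘ₗ f) ∘ₗ
      (MonoidAlgebra.coeffLinearEquiv k).toLinearMap)
    fun g => by
      ext h x
      have := LinearMap.congr_fun (hf g) x
      simp only [LinearMap.comp_apply] at this
      simp [ofMulAction_single, mul_inv_rev, this]

/-- The inverse appears because `H` acts on the coinvariant model by right translation by inverses.
-/
theorem indLift_mk (φ : G →* H) (ρ : Representation k G A) (τ : Representation k H B)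
    (f : A →ₗ[k] B) (hf : ∀ g, f ∘ₗ ρ g = τ (φ g) ∘ₗ f) (h : H) (a : A) :
    indLift φ ρ τ f hf (IndV.mk φ ρ h a) = τ h⁻¹ (f a) := by
  simp [indLift]

theorem indLift_ind (φ : G →* H) (ρ : Representation k G A) (τ : Representation k H B)
    (f : A →ₗ[k] B) (hf : ∀ g, f ∘ₗ ρ g = τ (φ g) ∘ₗ f) (h : H) :
    indLift φ ρ τ f hf ∘ₗ ind φ ρ h = τ h ∘ₗ indLift φ ρ τ f hf := by
  refine IndV.hom_ext _ _ fun h' => LinearMap.ext fun a => ?_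
  change indLift φ ρ τ f hf (ind φ ρ h (IndV.mk φ ρ h' a)) =
    τ h (indLift φ ρ τ f hf (IndV.mk φ ρ h' a))
  rw [ind_mk, indLift_mk, indLift_mk, mul_inv_rev, inv_inv, map_mul]
  rfl

theorem indV_mk_mul (φ : G →* H) (ρ : Representation k G A) (g : G) (h : H) (a : A) :
    IndV.mk φ ρ (φ g * h) a = IndV.mk φ ρ h (ρ g⁻¹ a) := by
  simp

/-- The added naturality clause lets one isomorphism serve every compatible pair of endomorphisms;
it is later applied to all elements of GL(V) at once. -/
theorem exists_equiv_ind {k G H A B : Type} [CommRing k] [Group G] [Group H] [AddCommGroup A]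
    [Module k A] [AddCommGroup B] [Module k B]
    (φ : G →* H) (ρ : Representation k G A) (τ : Representation k H B)
    (f : A →ₗ[k] B) (hf : ∀ g, f ∘ₗ ρ g = τ (φ g) ∘ₗ f)
    (hbij : Function.Bijective (indLift φ ρ τ f hf)) :
    ∃ e : τ.Equiv (Rep.ind φ (Rep.of ρ)).ρ, ∀ (T : ρ.IntertwiningMap ρ) (S : B →ₗ[k] B),
      (∀ h, S ∘ₗ τ h = τ h ∘ₗ S) → f ∘ₗ T.toLinearMap = S ∘ₗ f →
        ∀ x, e (S x) = (Rep.indMap φ (Rep.ofHom T)).hom (e x) := by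
  let E : (ind φ ρ).Equiv τ :=
    Representation.Equiv.mk (LinearEquiv.ofBijective _ hbij) (indLift_ind φ ρ τ f hf)
  refine ⟨E.symm, fun T S hS hT x => ?_⟩
  obtain ⟨y, rfl⟩ : ∃ y, E y = x := hbij.2 x
  have key : indLift φ ρ τ f hf ∘ₗ (Rep.indMap φ (Rep.ofHom T)).hom.toLinearMap =
      S ∘ₗ indLift φ ρ τ f hf := by
    refine IndV.hom_ext _ _ fun h => LinearMap.ext fun a => ?_
    have h1 : (Rep.indMap φ (Rep.ofHom T)).hom (IndV.mk φ ρ h a) = IndV.mk φ ρ h (T a) := by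
      simp [Rep.indMap]
    change indLift φ ρ τ f hf ((Rep.indMap φ (Rep.ofHom T)).hom (IndV.mk φ ρ h a)) =
      S (indLift φ ρ τ f hf (IndV.mk φ ρ h a))
    rw [h1, indLift_mk, indLift_mk]
    have h2 := LinearMap.congr_fun hT a
    have h3 := LinearMap.congr_fun (hS h⁻¹) (f a)
    simp only [LinearMap.comp_apply] at h2 h3
    rw [h3, ← h2]
    rfl
  have hy : S (E y) = E ((Rep.indMap φ (Rep.ofHom T)).hom y) :=
    (LinearMap.congr_fun key y).symm
  rw [hy, Representation.Equiv.symm_apply_apply, Representation.Equiv.symm_apply_apply]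

end IndLift

/-! ### Cosets of the Young subgroup -/

section Young

open Representation

variable {n i : ℕ}

theorem youngHom_castLE (hi : i ≤ n) (p : Equiv.Perm (Fin i) × Equiv.Perm (Fin (n - i)))
    (l : Fin i) : youngHom hi p (Fin.castLE hi l) = Fin.castLE hi (p.1 l) := by
  have h : ∀ l : Fin i, (finSumFinEquiv.trans (finCongr (Nat.add_sub_of_le hi))) (Sum.inl l) =
    Fin.castLE hi l := fun _ => rfl
  rw [← h, ← h]
  simp [youngHom, Equiv.permCongrHom]

theorem exists_youngHom_eq (hi : i ≤ n) (τ : Equiv.Perm (Fin n))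
    (hτ : ∀ l : Fin i, ∃ l' : Fin i, τ (Fin.castLE hi l) = Fin.castLE hi l') :
    ∃ p, youngHom hi p = τ := by
  let e := finSumFinEquiv.trans (finCongr (Nat.add_sub_of_le hi))
  have h : ∀ l : Fin i, e (Sum.inl l) = Fin.castLE hi l := fun _ => rfl
  obtain ⟨p, hp⟩ := Equiv.Perm.mem_sumCongrHom_range_of_perm_mapsTo_inl
    (σ := e.symm.permCongr τ) (by
      rintro _ ⟨l, rfl⟩
      obtain ⟨l', hl'⟩ := hτ l
      refine ⟨l', ?_⟩
      rw [Equiv.permCongr_apply, Equiv.symm_symm, h, hl', ← h, Equiv.symm_apply_apply])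
  refine ⟨p, ?_⟩
  change e.permCongr (Equiv.Perm.sumCongrHom _ _ p) = τ
  rw [hp]
  ext x
  simp

/-- The set of letters that a permutation sends to the first `i` letters. -/
def firstPreimage (hi : i ≤ n) (σ : Equiv.Perm (Fin n)) : Finset (Fin n) :=
  Finset.univ.image fun l : Fin i => σ⁻¹ (Fin.castLE hi l)

theorem card_firstPreimage (hi : i ≤ n) (σ : Equiv.Perm (Fin n)) :
    (firstPreimage hi σ).card = i := by
  rw [firstPreimage, Finset.card_image_of_injective]
  · simp
  · exact σ⁻¹.injective.comp (Fin.castLE_injective hi)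

/-- Under the hypothesis `σ * τ⁻¹` preserves the first block, hence lies in the Young subgroup. -/
theorem exists_youngHom_mul (hi : i ≤ n) {σ τ : Equiv.Perm (Fin n)}
    (h : firstPreimage hi σ = firstPreimage hi τ) : ∃ p, youngHom hi p * τ = σ := by
  obtain ⟨p, hp⟩ := exists_youngHom_eq hi (σ * τ⁻¹) fun l => by
    have hl : τ⁻¹ (Fin.castLE hi l) ∈ firstPreimage hi σ := by
      rw [h]
      exact Finset.mem_image_of_mem _ (Finset.mem_univ l)
    obtain ⟨l', -, hl'⟩ := Finset.mem_image.1 hl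
    exact ⟨l', by
      rw [Equiv.Perm.mul_apply, ← hl']
      exact σ.apply_symm_apply _⟩
  exact ⟨p, by rw [hp, inv_mul_cancel_right]⟩

/-- One copy of `A` per coset spans the induced module, and cosets are separated by the `i`-subsets
`firstPreimage`. The upper bound suffices, since surjectivity onto the cohomology supplies the other
inequality. -/
theorem finite_and_finrank_indV_le {k : Type} [Field k] {A : Type} [AddCommGroup A] [Module k A]
    [Module.Finite k A] (hi : i ≤ n)
    (ρ : Representation k (Equiv.Perm (Fin i) × Equiv.Perm (Fin (n - i))) A) :
    Module.Finite k (IndV (youngHom hi) ρ) ∧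
      Module.finrank k (IndV (youngHom hi) ρ) ≤ n.choose i * Module.finrank k A := by
  classical
  let I := {Q : Finset (Fin n) // Q.card = i}
  -- A coset representative for each subset; only subsets of the form `firstPreimage hi σ` are used,
  -- so the default value 1 is harmless.
  let s : I → Equiv.Perm (Fin n) := fun Q =>
    if h : ∃ σ, firstPreimage hi σ = Q.1 then h.choose else 1
  have hs : ∀ σ : Equiv.Perm (Fin n),
      firstPreimage hi (s ⟨firstPreimage hi σ, card_firstPreimage hi σ⟩) = firstPreimage hi σ := by
    intro σ
    have h : ∃ σ', firstPreimage hi σ' = firstPreimage hi σ := ⟨σ, rfl⟩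
    simp only [s, dif_pos h]
    exact h.choose_spec
  let F : (I → A) →ₗ[k] IndV (youngHom hi) ρ :=
    LinearMap.lsum k (fun _ => A) k fun Q => IndV.mk (youngHom hi) ρ (s Q)
  have hF : Function.Surjective F := by
    -- Surjectivity becomes the vanishing of the quotient map by the range, which can be tested on
    -- the elements `IndV.mk`.
    rw [← LinearMap.range_eq_top, ← Submodule.ker_mkQ (LinearMap.range F), LinearMap.ker_eq_top]
    refine IndV.hom_ext _ _ fun σ => LinearMap.ext fun a => ?_
    refine (Submodule.Quotient.mk_eq_zero _).2 ?_
    obtain ⟨p, hp⟩ := exists_youngHom_mul hi (hs σ).symm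
    refine ⟨Pi.single ⟨firstPreimage hi σ, card_firstPreimage hi σ⟩ (ρ p⁻¹ a), ?_⟩
    refine (LinearMap.lsum_piSingle k _ _ _ _ _).trans ?_
    rw [← indV_mk_mul, hp]
  have := Module.Finite.of_surjective F hF
  refine ⟨this, (LinearMap.finrank_le_finrank_of_surjective hF).trans ?_⟩
  rw [Module.finrank_pi_fintype]
  simp [I, Fintype.card_finset_len]

end Young

/-! ### A criterion for being induced from the twisted representation -/

section Twist

open TensorProduct

variable {k : Type} [Field k] {A : Type} [AddCommGroup A] [Module k A] {i n : ℕ}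

variable (k A) in
/-- The inclusion `A → (A ⊗ k) ⊗ k`. -/
def twistIncl : A →ₗ[k] (A ⊗[k] k) ⊗[k] k :=
  (TensorProduct.rid k _).symm.toLinearMap ∘ₗ (TensorProduct.rid k A).symm.toLinearMap

theorem twistIncl_apply (a : A) : twistIncl k A a = (a ⊗ₜ 1) ⊗ₜ 1 := rfl

theorem twist_hom_ext {B : Type*} [AddCommGroup B] [Module k B]
    {f g : (A ⊗[k] k) ⊗[k] k →ₗ[k] B} (h : ∀ a, f (twistIncl k A a) = g (twistIncl k A a)) :
    f = g := by
  ext a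
  exact h a

theorem twistRep_twistIncl (ρ : Representation k (Equiv.Perm (Fin i)) A)
    (p : Equiv.Perm (Fin i) × Equiv.Perm (Fin n)) (a : A) :
    twistRep ρ n p (twistIncl k A a) =
      ((Equiv.Perm.sign p.1 : ℤ) : k) • twistIncl k A (ρ p.1 a) := by
  have h : ((Equiv.Perm.sign p.1 : ℤ) : k) • ((ρ p.1 a ⊗ₜ[k] (1 : k)) ⊗ₜ[k] (1 : k)) =
      (ρ p.1 a ⊗ₜ[k] ((Equiv.Perm.sign p.1 : ℤ) : k)) ⊗ₜ[k] (1 : k) := by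
    rw [TensorProduct.smul_tmul', ← TensorProduct.tmul_smul, smul_eq_mul, mul_one]
  rw [twistIncl_apply, twistIncl_apply, h]
  simp [twistRep, extTensor, signRep]

theorem twistMap_twistIncl {ρ : Representation k (Equiv.Perm (Fin i)) A}
    (T : ρ.IntertwiningMap ρ) (a : A) :
    (twistMap T n).toLinearMap (twistIncl k A a) = twistIncl k A (T a) := by
  simp [twistMap, twistIncl_apply]

/-- The linear map on `(A ⊗ k) ⊗ k` given by a linear map on `A`. -/
def twistLift {B : Type*} [AddCommGroup B] [Module k B] (f : A →ₗ[k] B) :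
    (A ⊗[k] k) ⊗[k] k →ₗ[k] B :=
  f ∘ₗ (TensorProduct.rid k A).toLinearMap ∘ₗ (TensorProduct.rid k _).toLinearMap

theorem twistLift_twistIncl {B : Type*} [AddCommGroup B] [Module k B] (f : A →ₗ[k] B) (a : A) :
    twistLift f (twistIncl k A a) = f a := by
  simp [twistLift, twistIncl_apply]

/-- A criterion for a representation of `S_n` to be induced from `S_i × S_{n-i}`. -/
theorem exists_equiv_indTwistRep [Module.Finite k A] (hi : i ≤ n)
    (ρ : Representation k (Equiv.Perm (Fin i)) A)
    {B : Type} [AddCommGroup B] [Module k B] [Module.Finite k B]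
    (τ : Representation k (Equiv.Perm (Fin n)) B) (f : A →ₗ[k] B)
    (hf : ∀ p a, ((Equiv.Perm.sign p.1 : ℤ) : k) • f (ρ p.1 a) = τ (youngHom hi p) (f a))
    (hspan : ∀ M : Submodule k B, (∀ σ a, τ σ (f a) ∈ M) → M = ⊤)
    (hrank : Module.finrank k B = n.choose i * Module.finrank k A) :
    ∃ e : τ.Equiv (indTwistRep hi ρ).ρ, ∀ (T : ρ.IntertwiningMap ρ) (S : B →ₗ[k] B),
      (∀ σ, S ∘ₗ τ σ = τ σ ∘ₗ S) → (∀ a, f (T a) = S (f a)) →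
        ∀ x, e (S x) = (indTwistMap hi T).hom (e x) := by
  have hf' : ∀ p, twistLift f ∘ₗ twistRep ρ (n - i) p = τ (youngHom hi p) ∘ₗ twistLift f :=
    fun p => twist_hom_ext fun a => by
      rw [LinearMap.comp_apply, LinearMap.comp_apply, twistRep_twistIncl, map_smul,
        twistLift_twistIncl, twistLift_twistIncl, hf]
  let F := indLift (youngHom hi) (twistRep ρ (n - i)) τ (twistLift f) hf'
  have hsurj : Function.Surjective F := by
    refine LinearMap.range_eq_top.1 (hspan _ fun σ a => ?_)
    refine ⟨Representation.IndV.mk _ _ σ⁻¹ (twistIncl k A a), ?_⟩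
    refine (indLift_mk _ _ _ _ _ _ _).trans ?_
    rw [inv_inv, twistLift_twistIncl]
  obtain ⟨h₁, h₂⟩ := finite_and_finrank_indV_le hi (twistRep ρ (n - i))
  have hA : Module.finrank k ((A ⊗[k] k) ⊗[k] k) = Module.finrank k A :=
    ((TensorProduct.rid k _).trans (TensorProduct.rid k A)).finrank_eq
  rw [hA, ← hrank] at h₂
  -- A surjection from a space of dimension at most that of the target is bijective.
  have hbij : Function.Bijective F :=
    ⟨(LinearMap.injective_iff_surjective_of_finrank_eq_finrank
      (le_antisymm h₂ (LinearMap.finrank_le_finrank_of_surjective hsurj))).2 hsurj, hsurj⟩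
  obtain ⟨e, he⟩ := exists_equiv_ind (youngHom hi) (twistRep ρ (n - i)) τ (twistLift f) hf' hbij
  refine ⟨e, fun T S hS hT => he (twistMap T (n - i)) S hS (twist_hom_ext fun a => ?_)⟩
  rw [LinearMap.comp_apply, LinearMap.comp_apply, twistMap_twistIncl, twistLift_twistIncl,
    twistLift_twistIncl, hT]

end Twist

/-! ### Identification of the cohomology with the induced representation -/

section Induced

open TensorProduct PiTensorProduct

variable {m n i : ℕ}

theorem permRep_charProd (σ : Equiv.Perm (Fin n)) (h : Fin i → Fin n)
    (ξ : Fin i → Module.Dual ℂ (V m)) :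
    permRep m n i σ (charProd ℂ (𝔤 m n) i fun l => singleChar (h l) (ξ l)) =
      charProd ℂ (𝔤 m n) i fun l => singleChar (σ (h l)) (ξ l) := by
  refine (cohomologyMap_charProd (permAct m n σ⁻¹) _).trans ?_
  congr 1
  refine funext fun l => ?_
  rw [singleChar, charComap_permAct, singleChar]
  congr 1
  refine funext fun j => ?_
  by_cases hj : j = σ (h l)
  · subst hj
    simp
  · rw [Pi.single_eq_of_ne hj, Pi.single_eq_of_ne]
    exact fun h' => hj (Equiv.Perm.inv_eq_iff_eq.1 h')

theorem glRep_charProd (a : GLV m) (h : Fin i → Fin n) (ξ : Fin i → Module.Dual ℂ (V m)) :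
    glRep m n i a (charProd ℂ (𝔤 m n) i fun l => singleChar (h l) (ξ l)) =
      charProd ℂ (𝔤 m n) i fun l => singleChar (h l) (dualRep m a (ξ l)) := by
  refine (cohomologyMap_charProd (glAct m n a⁻¹) _).trans ?_
  congr 1
  refine funext fun l => ?_
  rw [singleChar, charComap_glAct, singleChar]
  congr 1
  refine funext fun j => ?_
  by_cases hj : j = h l
  · subst hj
    simp only [Pi.single_eq_same]
    rfl
  · rw [Pi.single_eq_of_ne hj, Pi.single_eq_of_ne hj, LinearMap.zero_comp]

/-- The product of the classes of characters of the first `i` summands. -/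
def firstProd (m : ℕ) {i n : ℕ} (hi : i ≤ n) :
    MultilinearMap ℂ (fun _ : Fin i => Module.Dual ℂ (V m)) (Cohomology ℂ (𝔤 m n) i) :=
  (charProd ℂ (𝔤 m n) i).toMultilinearMap.compLinearMap fun l =>
    genChar m n ∘ₗ LinearMap.single ℂ (fun _ => Module.Dual ℂ (V m)) (Fin.castLE hi l)

/-- The map from `(V^*)^{⊗i}` to cohomology given by `firstProd`. -/
def powerMap (m : ℕ) {i n : ℕ} (hi : i ≤ n) :
    (⨂[ℂ] _ : Fin i, Module.Dual ℂ (V m)) →ₗ[ℂ] Cohomology ℂ (𝔤 m n) i :=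
  PiTensorProduct.lift (firstProd m hi)

theorem powerMap_tprod (hi : i ≤ n) (ξ : Fin i → Module.Dual ℂ (V m)) :
    powerMap m hi (tprod ℂ ξ) =
      charProd ℂ (𝔤 m n) i fun l => singleChar (Fin.castLE hi l) (ξ l) :=
  PiTensorProduct.lift.tprod ξ

/-- The second factor fixes the first `i` summands. The first factor reorders the factors of an
alternating product, which produces the sign. -/
theorem powerMap_equivariant (hi : i ≤ n)
    (p : Equiv.Perm (Fin i) × Equiv.Perm (Fin (n - i)))
    (x : ⨂[ℂ] _ : Fin i, Module.Dual ℂ (V m)) :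
    ((Equiv.Perm.sign p.1 : ℤ) : ℂ) •
        powerMap m hi (tensorPowerRep ℂ (Module.Dual ℂ (V m)) i p.1 x) =
      permRep m n i (youngHom hi p) (powerMap m hi x) := by
  suffices h : ((Equiv.Perm.sign p.1 : ℤ) : ℂ) •
      powerMap m hi ∘ₗ tensorPowerRep ℂ (Module.Dual ℂ (V m)) i p.1 =
        permRep m n i (youngHom hi p) ∘ₗ powerMap m hi from LinearMap.congr_fun h x
  refine PiTensorProduct.ext (MultilinearMap.ext fun ξ => ?_)
  have h₁ : tensorPowerRep ℂ (Module.Dual ℂ (V m)) i p.1 (tprod ℂ ξ) =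
      tprod ℂ fun l => ξ (p.1⁻¹ l) :=
    PiTensorProduct.reindex_tprod _ _
  change ((Equiv.Perm.sign p.1 : ℤ) : ℂ) •
      powerMap m hi (tensorPowerRep ℂ (Module.Dual ℂ (V m)) i p.1 (tprod ℂ ξ)) =
    permRep m n i (youngHom hi p) (powerMap m hi (tprod ℂ ξ))
  rw [h₁, powerMap_tprod, powerMap_tprod, permRep_charProd, Int.cast_smul_eq_zsmul]
  have h₂ := (charProd ℂ (𝔤 m n) i).map_perm
    (fun l => singleChar (Fin.castLE hi l) (ξ (p.1⁻¹ l))) p.1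
  simp only [youngHom_castLE]
  refine h₂.symm.trans ?_
  congr 1
  refine funext fun l => ?_
  simp

theorem eq_top_of_permRep_powerMap_mem (hi : i ≤ n) (M : Submodule ℂ (Cohomology ℂ (𝔤 m n) i))
    (hM : ∀ σ x, permRep m n i σ (powerMap m hi x) ∈ M) : M = ⊤ := by
  rw [eq_top_iff, ← prodSpan_zero_eq_top, prodSpan, Submodule.span_le]
  rintro _ ⟨h, ξ, hh, -, rfl⟩
  have := Equiv.Perm.isMultiplyPretransitive (Fin n) i
  -- Multiple transitivity of `S_n` moves the first `i` summands to the prescribed distinct ones.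
  obtain ⟨σ, hσ⟩ := MulAction.exists_smul_eq (Equiv.Perm (Fin n)) (Fin.castLEEmb hi)
    ⟨h, hh.injective⟩
  have h₁ := hM σ (tprod ℂ ξ)
  rw [powerMap_tprod, permRep_charProd] at h₁
  have hl : ∀ l, σ (Fin.castLE hi l) = h l := fun l => DFunLike.congr_fun hσ l
  simpa only [hl, SetLike.mem_coe] using h₁

theorem finite_and_finrank_tensorPower (m i : ℕ) :
    Module.Finite ℂ (⨂[ℂ] _ : Fin i, Module.Dual ℂ (V m)) ∧
      Module.finrank ℂ (⨂[ℂ] _ : Fin i, Module.Dual ℂ (V m)) = m ^ i := by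
  let b : Module.Basis (Fin m) ℂ (Module.Dual ℂ (V m)) := (Pi.basisFun ℂ (Fin m)).dualBasis
  let B := Basis.piTensorProduct fun _ : Fin i => b
  refine ⟨Module.Finite.of_basis B, ?_⟩
  rw [Module.finrank_eq_card_basis B]
  simp

/-- On the spanning products one action changes the linear forms and the other the summand indices.
-/
theorem glRep_comp_permRep (a : GLV m) (σ : Equiv.Perm (Fin n)) :
    glRep m n i a ∘ₗ permRep m n i σ = permRep m n i σ ∘ₗ glRep m n i a := by
  refine LinearMap.ext_on (prodSpan_zero_eq_top m n i) ?_
  rintro _ ⟨h, ξ, -, -, rfl⟩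
  rw [LinearMap.comp_apply, LinearMap.comp_apply, permRep_charProd, glRep_charProd,
    glRep_charProd, permRep_charProd]

theorem powerMap_dualRep (hi : i ≤ n) (a : GLV m) (x : ⨂[ℂ] _ : Fin i, Module.Dual ℂ (V m)) :
    powerMap m hi (tensorPowerMap i (dualRep m a) x) = glRep m n i a (powerMap m hi x) := by
  suffices h : powerMap m hi ∘ₗ (tensorPowerMap i (dualRep m a)).toLinearMap =
      glRep m n i a ∘ₗ powerMap m hi from LinearMap.congr_fun h x
  refine PiTensorProduct.ext (MultilinearMap.ext fun ξ => ?_)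
  have h₁ : tensorPowerMap i (dualRep m a) (tprod ℂ ξ) = tprod ℂ fun l => dualRep m a (ξ l) :=
    PiTensorProduct.map_tprod _ _
  change powerMap m hi (tensorPowerMap i (dualRep m a) (tprod ℂ ξ)) =
    glRep m n i a (powerMap m hi (tprod ℂ ξ))
  rw [h₁, powerMap_tprod, powerMap_tprod, glRep_charProd]

theorem exists_equiv_indRep (m : ℕ) {i n : ℕ} (hi : i ≤ n) :
    ∃ e : (permRep m n i).Equiv (indRep ℂ (Module.Dual ℂ (V m)) hi).ρ,
      ∀ (a : GLV m) (x : Cohomology ℂ (𝔤 m n) i),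
        e (glRep m n i a x) = (indMap hi (dualRep m a)).hom (e x) := by
  obtain ⟨h₁, h₂⟩ := finite_and_finrank_tensorPower m i
  have := cohomology_finite m n i
  obtain ⟨e, he⟩ := exists_equiv_indTwistRep (A := ⨂[ℂ] _ : Fin i, Module.Dual ℂ (V m)) hi
    (tensorPowerRep ℂ (Module.Dual ℂ (V m)) i) (permRep m n i) (powerMap m hi)
    (powerMap_equivariant hi) (eq_top_of_permRep_powerMap_mem hi)
    (by rw [cohomology_finrank, h₂])
  exact ⟨e, fun a => he (tensorPowerMap i (dualRep m a)) (glRep m n i a)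
    (glRep_comp_permRep a) (powerMap_dualRep hi a)⟩

end Induced

end FreeLieCoh

end

theorem proposition2p1 (m n : ℕ) :
    (∀ (i : ℕ) (hi : i ≤ n),
      ∃ e : (FreeLieCoh.permRep m n i).Equiv
          (FreeLieCoh.indRep ℂ (Module.Dual ℂ (FreeLieCoh.V m)) hi).ρ,
        ∀ (a : FreeLieCoh.GLV m) (x : FreeLieCoh.Cohomology ℂ (FreeLieCoh.𝔤 m n) i),
          e (FreeLieCoh.glRep m n i a x) =
            (FreeLieCoh.indMap hi (FreeLieCoh.dualRep m a)).hom (e x)) ∧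
    (∀ i : ℕ, n < i → Subsingleton (FreeLieCoh.Cohomology ℂ (FreeLieCoh.𝔤 m n) i)) := by
  exact ⟨fun _ hi => FreeLieCoh.exists_equiv_indRep m hi,
    fun _ h => FreeLieCoh.cohomology_subsingleton m h⟩
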